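/- For an integer $\lambda\ge 1$ let $N=\lfloor\lambda^{1/2}\rfloor+1$ and $$\mathcal F_{5,\lambda}=\{\xi=(\xi_1,\dots,\xi_5)\in\mathbb Z^5:\ |\xi_1|^2+\dots+|\xi_5|^2=\lambda\}.$$ For a finite set $\Lambda\subset\mathbb Z^5$ let $$\mathbb E(\Lambda)=|\{(\xi_1,\xi_2,\xi_3,\xi_4)\in\Lambda^4:\ \xi_1+\xi_2=\xi_3+\xi_4\}|$$ be its additive energy. Then for every $\epsilon>0$ there is a constant $C_\epsilon>0$, depending only on $\epsilon$, such that for every integer $\lambda\ge 1$ and every subset $\Lambda\subset\mathcal F_{5,\lambda}$ $$\mathbb E(\Lambda)\le C_\epsilon\, N^{\epsilon}\,|\Lambda|^{5/2}.$$ -/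

import Mathlib

/-- The lattice points on the sphere of radius `√lam` centred at the origin of `ℝⁿ`. -/
def latticeSphere (n lam : ℕ) : Set (Fin n → ℤ) :=
  {ξ | ∑ i, |ξ i| ^ 2 = (lam : ℤ)}

/-- The sphere has finitely many lattice points, so its subsets are exactly the finsets
contained in it. -/
theorem latticeSphere_finite (n lam : ℕ) : (latticeSphere n lam).Finite := by
  refine (Set.finite_Icc (fun _ : Fin n => -(lam : ℤ)) (fun _ => (lam : ℤ))).subset ?_
  intro ξ hξ
  have key : ∀ i, |ξ i| ≤ (lam : ℤ) := by
    intro i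
    have h1 : |ξ i| ^ 2 ≤ (lam : ℤ) := by
      have h : ∑ i, |ξ i| ^ 2 = (lam : ℤ) := hξ
      rw [← h]
      exact Finset.single_le_sum (f := fun j => |ξ j| ^ 2) (fun j _ => by positivity)
        (Finset.mem_univ i)
    have h2 := Int.le_self_sq |ξ i|
    exact h2.trans h1
  exact ⟨fun i => (abs_le.mp (key i)).1, fun i => (abs_le.mp (key i)).2⟩

/-- The scale `N = ⌊√lam⌋ + 1`. -/
def scaleN (lam : ℕ) : ℕ := Nat.sqrt lam + 1

/-! Let `r(v)` count the pairs in `Λ` with sum `v`, so the energy is `∑ r(v)²`. If `x + y = v` with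
`x, y` on the sphere, then `|v - x| = |x|`, that is `2 x·v = |v|²`. Hence `r(v)` is at most the
number of `a ∈ Λ` whose functional `(y, z) ↦ 2 a·y - z` on `ℝ⁶` vanishes at the lift `(v, |v|²)`.
With `n = #Λ` and `m` the number of nonzero `v` with `r(v) ≥ k`, it suffices, up to a logarithm, to
show `m k² ≲ n^(5/2)` for every `k`.

The arithmetic input is that a circle on such a sphere carries at most `B = N^o(1)` lattice points:
completing the square turns them into representations `x² + D y² = M` with `M` polynomial in `lam`,
counted by divisors. Three hyperplanes with independent normals `v` cut the sphere in a circle, and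
the `v` incident to a fixed `a` and lying in a given plane through `0` form a circle too. So
incidences between `a` and `v` nearly avoid a complete bipartite graph on three points and `B`
hyperplanes (`exists_card_common_neighbours_le`).

The geometric input is a cutting (`exists_cutting`): the lifts split into `O(s⁵)` classes (five is
the projective dimension), each met but not contained by at most `nB/s` hyperplanes. For `s` about
`n / k^(3/2)`, a Kővári–Sós–Turán count in each class (`card_class_le`) gives `m ≲ s⁵ + s⁴ n / k` up
to powers of `B`, which is enough when `k ≥ √n`. When `k < √n`, the trivial `m k ≤ n²` suffices. -/

/-! ### Decomposition of central arrangements into simplicial cones -/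

/-- A point off finitely many hyperplanes can be moved, without crossing them, off finitely many
further hyperplanes. -/
theorem exists_generic_same_side {E : Type*} [AddCommGroup E] [Module ℝ E]
    (p : E) (S G : Finset (Module.Dual ℝ E)) (hS : ∀ f ∈ S, f p ≠ 0) (hG : ∀ h ∈ G, h ≠ 0) :
    ∃ x, (∀ f ∈ S, 0 < f x * f p) ∧ ∀ h ∈ G, h x ≠ 0 := by
  -- The point `p + t • y`, with `y` off all of `G` and `t > 0` small, keeps the strict signs of
  -- `S`.
  obtain ⟨y, -, hy⟩ := Module.Dual.exists_forall_mem_ne_zero_of_forall_exists (K := ℝ) (M := E) ⊤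
    (fun h : G => (h : Module.Dual ℝ E)) (by
      rintro ⟨h, hh⟩
      by_contra! hc
      exact hG h hh (LinearMap.ext fun x => hc x trivial))
  have e1 : ∀ f ∈ S, ∀ᶠ t : ℝ in nhdsWithin 0 (Set.Ioi 0), 0 < f (p + t • y) * f p := by
    intro f hf
    have hc : Filter.Tendsto (fun t : ℝ => f (p + t • y) * f p) (nhds 0)
        (nhds (f p * f p)) := by
      have : Continuous fun t : ℝ => f (p + t • y) * f p := by
        simp only [map_add, map_smul, smul_eq_mul]; fun_prop
      simpa using this.tendsto 0
    exact (hc.eventually (lt_mem_nhds (mul_self_pos.2 (hS f hf)))).filter_mono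
      nhdsWithin_le_nhds
  have e2 : ∀ h ∈ G, ∀ᶠ t : ℝ in nhdsWithin 0 (Set.Ioi 0), h (p + t • y) ≠ 0 := by
    intro h hh
    have hy' : h y ≠ 0 := hy ⟨h, hh⟩
    by_cases hp : h p = 0
    · filter_upwards [self_mem_nhdsWithin] with t ht
      have : t ≠ 0 := ne_of_gt ht
      simp [hp, hy', this]
    · have hc : Filter.Tendsto (fun t : ℝ => h (p + t • y)) (nhds 0) (nhds (h p)) := by
        have : Continuous fun t : ℝ => h (p + t • y) := by
          simp only [map_add, map_smul, smul_eq_mul]; fun_prop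
        simpa using this.tendsto 0
      exact (hc.eventually_ne hp).filter_mono nhdsWithin_le_nhds
  obtain ⟨t, h1, h2⟩ := (((Filter.eventually_all_finset S).2 e1).and
    ((Filter.eventually_all_finset G).2 e2)).exists
  exact ⟨p + t • y, h1, h2⟩

/-- `X` spans a (possibly degenerate) simplicial cone containing `p` in its relative interior, and
no functional of `S` takes both signs on that cone. -/
def IsConeAround {E : Type*} [AddCommGroup E] [Module ℝ E] {D : ℕ}
    (S : Finset (Module.Dual ℝ E)) (p : E) (X : Fin D → E) : Prop :=
  (∃ w : Fin D → ℝ, (∀ i, 0 < w i) ∧ p = ∑ i, w i • X i) ∧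
    ∀ f ∈ S, (∀ i, 0 ≤ f (X i)) ∨ (∀ i, f (X i) ≤ 0)

/-- The weights are positive and `f` has constant sign on the cone, so nothing cancels. The cone
thus remembers the signs at `p`, which the counting of cones exploits. -/
theorem IsConeAround.pos_iff {E : Type*} [AddCommGroup E] [Module ℝ E] {D : ℕ}
    {S : Finset (Module.Dual ℝ E)} {p : E} {X : Fin D → E} (h : IsConeAround S p X)
    {f : Module.Dual ℝ E} (hf : f ∈ S) : 0 < f p ↔ ∃ i, 0 < f (X i) := by
  obtain ⟨⟨w, hw, rfl⟩, h2⟩ := h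
  have e : f (∑ i, w i • X i) = ∑ i, w i * f (X i) := by simp
  rw [e]
  constructor
  · intro hp
    obtain ⟨i, -, hi⟩ := Finset.exists_lt_of_sum_lt (s := Finset.univ) (f := fun _ => (0 : ℝ))
      (g := fun i => w i * f (X i)) (by simpa using hp)
    exact ⟨i, (pos_iff_pos_of_mul_pos hi).1 (hw i)⟩
  · rintro ⟨i, hi⟩
    have h0 : ∀ j, 0 ≤ f (X j) := by
      rcases h2 f hf with h | h
      · exact h
      · exact absurd (h i) (not_le.2 hi)
    exact Finset.sum_pos' (fun j _ => mul_nonneg (hw j).le (h0 j))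
      ⟨i, Finset.mem_univ _, mul_pos (hw i) hi⟩

/-- A functional vanishing at an interior point of a cone on which it has constant sign vanishes
on the whole cone. -/
theorem eq_zero_of_sum_eq_zero {E : Type*} [AddCommGroup E] [Module ℝ E] {D : ℕ}
    {f : Module.Dual ℝ E} {X : Fin D → E} {w : Fin D → ℝ} (hw : ∀ i, 0 < w i)
    (hf : (∀ i, 0 ≤ f (X i)) ∨ (∀ i, f (X i) ≤ 0)) (h0 : f (∑ i, w i • X i) = 0) (i : Fin D) :
    f (X i) = 0 := by
  have e : ∑ i, w i * f (X i) = 0 := by simpa using h0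
  rcases hf with hf | hf
  · have := (Finset.sum_eq_zero_iff_of_nonneg
      (fun j _ => mul_nonneg (hw j).le (hf j))).1 e i (Finset.mem_univ _)
    exact (mul_eq_zero.1 this).resolve_left (hw i).ne'
  · have := (Finset.sum_eq_zero_iff_of_nonpos
      (fun j _ => mul_nonpos_of_nonneg_of_nonpos (hw j).le (hf j))).1 e i (Finset.mem_univ _)
    exact (mul_eq_zero.1 this).resolve_left (hw i).ne'

/-- Pads with a redundant generator, so that cones found inside a hyperplane have the ambient number
of generators. -/
theorem IsConeAround.cons_zero {E : Type*} [AddCommGroup E] [Module ℝ E] {D : ℕ}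
    {S : Finset (Module.Dual ℝ E)} {p : E} {X : Fin D → E} (h : IsConeAround S p X) :
    IsConeAround S p (Fin.cons 0 X : Fin (D + 1) → E) := by
  obtain ⟨⟨w, hw, hp⟩, h2⟩ := h
  refine ⟨⟨Fin.cons 1 w, ?_, ?_⟩, ?_⟩
  · intro i; refine Fin.cases ?_ (fun j => ?_) i <;> simp [hw]
  · simp [Fin.sum_univ_succ, hp]
  · intro f hf
    rcases h2 f hf with h | h
    · left; intro i; refine Fin.cases ?_ (fun j => ?_) i <;> simp [h]
    · right; intro i; refine Fin.cases ?_ (fun j => ?_) i <;> simp [h]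

/-- A functional nonzero at `q` has a weakly compatible sign at `x`. One vanishing at the interior
point `q` vanishes on all of `X`, and then only its sign at `x` matters. -/
theorem IsConeAround.cons {E : Type*} [AddCommGroup E] [Module ℝ E] {D : ℕ}
    {S : Finset (Module.Dual ℝ E)} {q x : E} {t : ℝ} {X : Fin D → E} (h : IsConeAround S q X)
    (ht : 0 < t) (hx : ∀ f ∈ S, 0 ≤ f q * f x) :
    IsConeAround S (q + t • x) (Fin.cons x X : Fin (D + 1) → E) := by
  obtain ⟨⟨w, hw, hp⟩, h2⟩ := h
  refine ⟨⟨Fin.cons t w, ?_, ?_⟩, ?_⟩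
  · intro i; refine Fin.cases ?_ (fun j => ?_) i <;> simp [hw, ht]
  · simp [Fin.sum_univ_succ, hp, add_comm]
  · intro f hf
    have hsum : f q = ∑ i, w i * f (X i) := by simp [hp]
    have hcons : ∀ P : ℝ → Prop, P (f x) → (∀ i, P (f (X i))) →
        ∀ i, P (f ((Fin.cons x X : Fin (D + 1) → E) i)) := by
      intro P h0 h1 i
      refine Fin.cases ?_ (fun j => ?_) i
      · simpa using h0
      · simpa using h1 j
    rcases eq_or_ne (f q) 0 with h0 | h0
    · have hX : ∀ i, f (X i) = 0 := eq_zero_of_sum_eq_zero hw (h2 f hf) (hp ▸ h0)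
      rcases le_total 0 (f x) with h | h
      · exact Or.inl (hcons (0 ≤ ·) h fun i => (hX i).ge)
      · exact Or.inr (hcons (· ≤ 0) h fun i => (hX i).le)
    · rcases h2 f hf with h | h
      · have hq : 0 ≤ f q := hsum ▸ Finset.sum_nonneg fun i _ => mul_nonneg (hw i).le (h i)
        have : 0 ≤ f x := nonneg_of_mul_nonneg_right (hx f hf) (lt_of_le_of_ne hq h0.symm)
        exact Or.inl (hcons (0 ≤ ·) this h)
      · have hq : f q ≤ 0 :=
          hsum ▸ Finset.sum_nonpos fun i _ => mul_nonpos_of_nonneg_of_nonpos (hw i).le (h i)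
        have hq' : f q < 0 := lt_of_le_of_ne hq h0
        have : f x ≤ 0 := by
          by_contra! hc
          exact absurd (hx f hf) (not_le.2 (mul_neg_of_neg_of_pos hq' hc))
        exact Or.inr (hcons (· ≤ 0) this h)

/-- Base of the induction: a line consists of the origin and two open rays. -/
theorem exists_cone_decomposition_line {E : Type*} [AddCommGroup E] [Module ℝ E]
    (hE : Module.finrank ℝ E = 1) (S : Finset (Module.Dual ℝ E)) (U : Finset E) :
    ∃ X : E → Fin 1 → E, (∀ p ∈ U, IsConeAround S p (X p)) ∧
      Set.ncard (X '' U) ≤ 3 := by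
  classical
  obtain ⟨e, -, he⟩ := finrank_eq_one_iff'.1 hE
  choose c hc using he
  refine ⟨fun p _ => ((SignType.sign (c p) : SignType) : ℝ) • e, ?_, ?_⟩
  · intro p _
    have hcp := hc p
    refine ⟨?_, fun f _ => ?_⟩
    · rcases lt_trichotomy (c p) 0 with h | h | h
      · refine ⟨fun _ => -c p, fun _ => by linarith, ?_⟩
        simp [h, hcp]
      · refine ⟨fun _ => 1, fun _ => one_pos, ?_⟩
        rw [h, zero_smul] at hcp
        simpa [h] using hcp.symm
      · refine ⟨fun _ => c p, fun _ => h, ?_⟩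
        simp [h, hcp]
    · rcases le_total 0 (f (((SignType.sign (c p) : SignType) : ℝ) • e)) with h | h
      · exact Or.inl fun _ => h
      · exact Or.inr fun _ => h
  · have hsub : (fun (p : E) (_ : Fin 1) => ((SignType.sign (c p) : SignType) : ℝ) • e) '' U ⊆
        (fun (σ : SignType) (_ : Fin 1) => ((σ : SignType) : ℝ) • e) '' Set.univ := by
      rintro _ ⟨p, -, rfl⟩
      exact ⟨SignType.sign (c p), trivial, rfl⟩
    calc _ ≤ _ := Set.ncard_le_ncard hsub (Set.toFinite _)
      _ ≤ (Set.univ : Set SignType).ncard := Set.ncard_image_le (Set.toFinite _)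
      _ = 3 := by rw [Set.ncard_univ]; simp [Nat.card_eq_fintype_card]; rfl

/-- The decomposition of a hyperplane, transported to the ambient space. -/
theorem exists_cone_decomposition_ker {E : Type*} [AddCommGroup E] [Module ℝ E] {k : ℕ}
    (S : Finset (Module.Dual ℝ E)) (hS : ∀ x, (∀ f ∈ S, f x = 0) → x = 0)
    (U : Finset E) (f : Module.Dual ℝ E)
    (ih : ∀ T : Finset (Module.Dual ℝ (LinearMap.ker f)), (∀ x, (∀ g ∈ T, g x = 0) → x = 0) →
      ∀ W : Finset (LinearMap.ker f), ∃ X : LinearMap.ker f → Fin (k + 1) → LinearMap.ker f,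
        (∀ p ∈ W, IsConeAround T p (X p)) ∧ Set.ncard (X '' W) ≤ 3 * (3 * T.card) ^ k) :
    ∃ Y : E → Fin (k + 1) → E, (∀ q ∈ U, f q = 0 → IsConeAround S q (Y q)) ∧
      Set.ncard (Y '' {q | q ∈ U ∧ f q = 0}) ≤ 3 * (3 * S.card) ^ k := by
  classical
  obtain ⟨X, hX, hcard⟩ := ih (S.image fun g => g.domRestrict (LinearMap.ker f)) (by
    intro x hx
    apply Subtype.ext
    apply hS
    intro g hg
    exact hx _ (Finset.mem_image_of_mem _ hg)) (U.subtype fun x => x ∈ LinearMap.ker f)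
  refine ⟨fun q i => if h : f q = 0 then (X ⟨q, h⟩ i : E) else 0, ?_, ?_⟩
  · intro q hq hfq
    obtain ⟨⟨w, hw, hp⟩, h2⟩ := hX ⟨q, hfq⟩ (Finset.mem_subtype.2 hq)
    refine ⟨⟨w, hw, ?_⟩, fun g hg => ?_⟩
    · simpa [hfq] using congrArg Subtype.val hp
    · simpa [hfq] using h2 _ (Finset.mem_image_of_mem _ hg)
  · have hsub : (fun (q : E) (i : Fin (k + 1)) => if h : f q = 0 then (X ⟨q, h⟩ i : E) else 0) ''
        {q | q ∈ U ∧ f q = 0} ⊆ (fun (Z : Fin (k + 1) → LinearMap.ker f) i => (Z i : E)) ''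
          (X '' (U.subtype fun x => x ∈ LinearMap.ker f)) := by
      rintro _ ⟨q, ⟨hq, hfq⟩, rfl⟩
      refine ⟨X ⟨q, hfq⟩, ⟨⟨q, hfq⟩, by simpa using hq, rfl⟩, ?_⟩
      simp [hfq]
    have hfin : (X '' (U.subtype fun x => x ∈ LinearMap.ker f)).Finite :=
      (Finset.finite_toSet _).image _
    calc _ ≤ _ := Set.ncard_le_ncard hsub (hfin.image _)
      _ ≤ _ := Set.ncard_image_le hfin
      _ ≤ _ := hcard
      _ ≤ _ := by gcongr; exact Finset.card_image_le

/-- In every sign cell of an arrangement one can choose an apex such that each ray through a point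
of `U` leaves the cell through a single hyperplane. -/
theorem exists_generic_apex {E : Type*} [AddCommGroup E] [Module ℝ E]
    (S : Finset (Module.Dual ℝ E)) (U : Finset E) (c : Set (Module.Dual ℝ E)) :
    ∃ x : E, ∀ p ∈ U, (∀ f ∈ S, f p ≠ 0) → {f | f ∈ S ∧ 0 < f p} = c →
      (∀ f ∈ S, 0 < f x * f p) ∧
        ∀ f ∈ S, ∀ g ∈ S, g p * f x = f p * g x → g p • f = f p • g := by
  classical
  by_cases hex : ∃ p ∈ U, (∀ f ∈ S, f p ≠ 0) ∧ {f | f ∈ S ∧ 0 < f p} = c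
  swap
  · exact ⟨0, fun p hp h1 h2 => (hex ⟨p, hp, h1, h2⟩).elim⟩
  obtain ⟨p₀, -, h0, rfl⟩ := hex
  obtain ⟨x, hx1, hx2⟩ := exists_generic_same_side p₀ S
    (((U ×ˢ S ×ˢ S).image fun z => z.2.2 z.1 • z.2.1 - z.2.1 z.1 • z.2.2).filter (· ≠ 0)) h0
    (by intro h hh; exact (Finset.mem_filter.1 hh).2)
  refine ⟨x, fun p hp hne hc => ⟨fun f hf => ?_, fun f hf g hg h => ?_⟩⟩
  · have hiff : 0 < f p ↔ 0 < f p₀ := by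
      have := congrArg (f ∈ ·) hc
      simpa [hf] using this
    have h1 := hx1 f hf
    rcases lt_or_gt_of_ne (h0 f hf) with h | h
    · have hp0 : f p < 0 := lt_of_le_of_ne (not_lt.1 fun h' => absurd (hiff.1 h') (not_lt.2 h.le))
        (hne f hf)
      exact mul_pos_of_neg_of_neg (neg_of_mul_pos_left h1 h.le) hp0
    · exact mul_pos (pos_of_mul_pos_left h1 h.le) (hiff.2 h)
  · by_contra hc
    refine hx2 (g p • f - f p • g) (Finset.mem_filter.2 ⟨?_, sub_ne_zero.2 hc⟩) ?_
    · exact Finset.mem_image.2 ⟨(p, f, g), by simp [hp, hf, hg], rfl⟩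
    · simp [h]

/-- Shooting a ray from the point `p` away from the apex `x` until the first hyperplane is hit. -/
theorem exists_first_hit {E : Type*} [AddCommGroup E] [Module ℝ E]
    (S : Finset (Module.Dual ℝ E)) (hS : S.Nonempty) (p x : E)
    (h1 : ∀ f ∈ S, 0 < f x * f p)
    (h2 : ∀ f ∈ S, ∀ g ∈ S, g p * f x = f p * g x → g p • f = f p • g) :
    ∃ f ∈ S, ∃ q, f q = 0 ∧ ∃ t : ℝ, 0 < t ∧ p = q + t • x ∧ (∀ g ∈ S, 0 ≤ g q * g x) ∧
      ∀ g ∈ S, g q = 0 → ∃ κ : ℝ, g = κ • f := by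
  -- The ray `p - t • x` meets the kernel of `g` at `t = g p / g x > 0`; the first hit minimises
  -- this.
  obtain ⟨f, hf, hmin⟩ := Finset.exists_min_image S (fun f => f p / f x) hS
  have hx : ∀ g ∈ S, g x ≠ 0 := fun g hg h => by simpa [h] using h1 g hg
  have hp : ∀ g ∈ S, g p ≠ 0 := fun g hg h => by simpa [h] using h1 g hg
  refine ⟨f, hf, p - (f p / f x) • x, ?_, f p / f x, ?_, by simp, ?_, ?_⟩
  · have := hx f hf
    simp; field_simp; simp
  · rcases pos_and_pos_or_neg_and_neg_of_mul_pos (h1 f hf) with h | h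
    · exact div_pos h.2 h.1
    · exact div_pos_of_neg_of_neg h.2 h.1
  · intro g hg
    have := hx g hg
    have e : g (p - (f p / f x) • x) * g x = (g x) ^ 2 * (g p / g x - f p / f x) := by
      simp only [map_sub, map_smul, smul_eq_mul]; field_simp
    rw [e]
    exact mul_nonneg (sq_nonneg _) (sub_nonneg.2 (hmin g hg))
  · intro g hg h0
    have hxf := hx f hf
    have e : g p * f x = f p * g x := by
      simp only [map_sub, map_smul, smul_eq_mul] at h0
      field_simp at h0
      linarith
    have := h2 f hf g hg e
    refine ⟨g p / f p, ?_⟩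
    rw [div_eq_inv_mul, mul_smul, this, smul_smul, inv_mul_cancel₀ (hp f hf), one_smul]

universe u

/-- Push each point away from the apex of its cell until it hits a hyperplane, decompose that
hyperplane, and cone back to the apex. Apexes do not multiply the count by the number of cells: the
hyperplane, the cone around the hit point and the side of the hyperplane already determine the cell.
-/
theorem exists_cone_decomposition_step {E : Type u} [AddCommGroup E] [Module ℝ E] {k : ℕ}
    (hE : Module.finrank ℝ E = k + 2)
    (S : Finset (Module.Dual ℝ E)) (hS : ∀ x, (∀ f ∈ S, f x = 0) → x = 0) (U : Finset E)
    (ih : ∀ f ∈ S, f ≠ 0 → ∀ W : Finset E, ∃ Y : E → Fin (k + 1) → E,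
      (∀ q ∈ W, f q = 0 → IsConeAround S q (Y q)) ∧
        Set.ncard (Y '' {q | q ∈ W ∧ f q = 0}) ≤ 3 * (3 * S.card) ^ k) :
    ∃ X : E → Fin (k + 2) → E, (∀ p ∈ U, IsConeAround S p (X p)) ∧
      Set.ncard (X '' U) ≤ 3 * (3 * S.card) ^ (k + 1) := by
  classical
  have : Nontrivial E := Module.nontrivial_of_finrank_pos (R := ℝ) (by omega)
  set S₀ := S.filter (· ≠ 0) with hS₀
  have hne : S₀.Nonempty := by
    obtain ⟨x, hx⟩ := exists_ne (0 : E)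
    by_contra hc
    rw [Finset.not_nonempty_iff_eq_empty, Finset.filter_eq_empty_iff] at hc
    exact hx (hS x fun f hf => by simp [not_not.1 (hc hf)])
  choose apex hapex using exists_generic_apex S₀ U
  let code : E → Set (Module.Dual ℝ E) := fun p => {f | f ∈ S₀ ∧ 0 < f p}
  have hhit : ∀ p ∈ U, ∃ f ∈ S₀, ∃ q, f q = 0 ∧ (q = p ∨ ((∀ g ∈ S₀, 0 < g (apex (code p)) * g p) ∧
      ∃ t : ℝ, 0 < t ∧ p = q + t • apex (code p) ∧ (∀ g ∈ S₀, 0 ≤ g q * g (apex (code p))) ∧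
      ∀ g ∈ S₀, g q = 0 → ∃ κ : ℝ, g = κ • f)) := by
    intro p hp
    by_cases h0 : ∃ f ∈ S₀, f p = 0
    · obtain ⟨f, hf, hfp⟩ := h0
      exact ⟨f, hf, p, hfp, Or.inl rfl⟩
    · push Not at h0
      obtain ⟨h1, h2⟩ := hapex (code p) p hp h0 rfl
      obtain ⟨f, hf, q, hq, h⟩ := exists_first_hit S₀ hne p _ h1 h2
      exact ⟨f, hf, q, hq, Or.inr ⟨h1, h⟩⟩
  choose! F hF Q hQ hQ' using hhit
  have ih' : ∀ f ∈ S₀, ∃ Y : E → Fin (k + 1) → E,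
      (∀ q ∈ U.image Q, f q = 0 → IsConeAround S q (Y q)) ∧
        Set.ncard (Y '' {q | q ∈ U.image Q ∧ f q = 0}) ≤ 3 * (3 * S.card) ^ k := fun f hf =>
    ih f (Finset.mem_filter.1 hf).1 (Finset.mem_filter.1 hf).2 _
  choose! Y hY hYcard using ih'
  have hYp : ∀ p ∈ U, IsConeAround S (Q p) (Y (F p) (Q p)) := fun p hp =>
    hY _ (hF p hp) _ (Finset.mem_image_of_mem _ hp) (hQ p hp)
  let X : E → Fin (k + 2) → E := fun p =>
    if Q p = p then Fin.cons 0 (Y (F p) (Q p)) else Fin.cons (apex (code p)) (Y (F p) (Q p))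
  refine ⟨X, fun p hp => ?_, ?_⟩
  · by_cases h : Q p = p
    · have := (hYp p hp).cons_zero
      simp only [X, if_pos h]
      rwa [h] at this ⊢
    · obtain ⟨-, t, ht, hpt, hsign, -⟩ := (hQ' p hp).resolve_left h
      simp only [X, if_neg h]
      have := (hYp p hp).cons ht (x := apex (code p)) (by
        intro g hg
        by_cases h0 : g = 0
        · simp [h0]
        · exact hsign g (Finset.mem_filter.2 ⟨hg, h0⟩))
      rwa [← hpt] at this
  -- Recovers the cell of `p` from `f`, the cone `Z` around the hit point and the bit `b` for `0 < f
  -- p`. Multiples of `f` get their sign from `b`; any other `g` is nonzero at the hit point, with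
  -- the same sign as at `p`, read off `Z`.
  · let recode : Module.Dual ℝ E → (Fin (k + 1) → E) → Prop → Set (Module.Dual ℝ E) :=
      fun f Z b => {g | g ∈ S₀ ∧ if ∃ κ : ℝ, g = κ • f then ∃ κ : ℝ, g = κ • f ∧ (0 < κ ↔ b)
        else ∃ i, 0 < g (Z i)}
    -- `none` stands for a point already on a hyperplane, `some b` for a side of `f`: three values,
    -- hence the factor 3.
    let Φ : Module.Dual ℝ E → (Fin (k + 1) → E) × Option Prop → Fin (k + 2) → E :=
      fun f z => z.2.elim (Fin.cons 0 z.1) fun b => Fin.cons (apex (recode f z.1 b)) z.1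
    have hrecode : ∀ p ∈ U, Q p ≠ p →
        recode (F p) (Y (F p) (Q p)) (0 < F p p) = code p := by
      intro p hp h
      obtain ⟨hx, t, ht, hpt, hsign, hprop⟩ := (hQ' p hp).resolve_left h
      have hnz : ∀ g ∈ S₀, g p ≠ 0 := fun g hg h => by simpa [h] using hx g hg
      ext g
      simp only [recode, code, Set.mem_ofPred_eq]
      refine and_congr_right fun hg => ?_
      split_ifs with hk
      · obtain ⟨κ, rfl⟩ := hk
        have hκ : κ ≠ 0 := fun h0 => (Finset.mem_filter.1 hg).2 (by simp [h0])
        have hFp := hnz _ (hF p hp)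
        have hF0 : F p ≠ 0 := (Finset.mem_filter.1 (hF p hp)).2
        have e : (∃ κ' : ℝ, κ • F p = κ' • F p ∧ (0 < κ' ↔ 0 < F p p)) ↔
            (0 < κ ↔ 0 < F p p) := by
          constructor
          · rintro ⟨κ', h1, h2⟩
            rwa [smul_left_injective ℝ hF0 h1]
          · exact fun h => ⟨κ, rfl, h⟩
        rw [e]
        simp only [LinearMap.smul_apply, smul_eq_mul]
        rcases lt_or_gt_of_ne hκ with h1 | h1 <;> rcases lt_or_gt_of_ne hFp with h2 | h2
        · simp [h1.not_gt, h2.not_gt, mul_pos_of_neg_of_neg h1 h2]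
        · simp [h1.not_gt, h2]
        · simp [h1, h2.not_gt]
        · simp [h1, h2]
      · rw [← (hYp p hp).pos_iff (Finset.mem_filter.1 hg).1]
        have hq : g (Q p) ≠ 0 := fun h0 => hk (hprop g hg h0)
        have h1 := hsign g hg
        have h2 := hx g hg
        rcases pos_and_pos_or_neg_and_neg_of_mul_pos h2 with ⟨ha, hb⟩ | ⟨ha, hb⟩
        · have : 0 ≤ g (Q p) := nonneg_of_mul_nonneg_left h1 ha
          simp [hb, lt_of_le_of_ne this hq.symm]
        · have : g (Q p) ≤ 0 := by
            by_contra! hc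
            exact absurd h1 (not_le.2 (mul_neg_of_pos_of_neg hc ha))
          exact iff_of_false (not_lt.2 this) (not_lt.2 hb.le)
    have hfin : ∀ f, (Y f '' {q | q ∈ U.image Q ∧ f q = 0}).Finite := fun f =>
      Set.Finite.image _ ((Finset.finite_toSet (U.image Q)).subset fun q hq => hq.1)
    have hsub : X '' U ⊆ ⋃ f ∈ S₀,
        Φ f '' ((Y f '' {q | q ∈ U.image Q ∧ f q = 0}) ×ˢ (Set.univ : Set (Option Prop))) := by
      rintro _ ⟨p, hp, rfl⟩
      refine Set.mem_biUnion (hF p hp) ?_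
      have hmem : Y (F p) (Q p) ∈ Y (F p) '' {q | q ∈ U.image Q ∧ F p q = 0} :=
        ⟨Q p, ⟨Finset.mem_image_of_mem _ hp, hQ p hp⟩, rfl⟩
      by_cases h : Q p = p
      · exact ⟨(Y (F p) (Q p), none), ⟨hmem, trivial⟩, by simp [Φ, X, h]⟩
      · refine ⟨(Y (F p) (Q p), some (0 < F p p)), ⟨hmem, trivial⟩, ?_⟩
        simp only [Φ, X, if_neg h, Option.elim, hrecode p hp h]
    have hfin' : ∀ f, (Φ f '' ((Y f '' {q | q ∈ U.image Q ∧ f q = 0}) ×ˢ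
        (Set.univ : Set (Option Prop)))).Finite := fun f =>
      ((hfin f).prod (Set.toFinite _)).image _
    calc Set.ncard (X '' U) ≤ _ :=
          Set.ncard_le_ncard hsub (Set.Finite.biUnion (Finset.finite_toSet _) fun f _ => hfin' f)
      _ ≤ ∑ f ∈ S₀, Set.ncard (Φ f '' ((Y f '' {q | q ∈ U.image Q ∧ f q = 0}) ×ˢ
            (Set.univ : Set (Option Prop)))) := Finset.set_ncard_biUnion_le _ _
      _ ≤ ∑ f ∈ S₀, 3 * (3 * S.card) ^ k * 3 := by
          refine Finset.sum_le_sum fun f hf => ?_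
          refine (Set.ncard_image_le ((hfin f).prod (Set.toFinite _))).trans ?_
          rw [Set.ncard_prod]
          have h3 : (Set.univ : Set (Option Prop)).ncard = 3 := by
            rw [Set.ncard_univ, Nat.card_eq_fintype_card, Fintype.card_option, Fintype.card_prop]
          rw [h3]
          exact Nat.mul_le_mul_right _ (hYcard f hf)
      _ ≤ S.card * (3 * (3 * S.card) ^ k * 3) := by
          rw [Finset.sum_const, smul_eq_mul]
          exact Nat.mul_le_mul_right _ (Finset.card_filter_le _ _)
      _ = 3 * (3 * S.card) ^ (k + 1) := by ring

/-- **Decomposition of a central arrangement into simplicial cones.** Given `S` functionals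
without common zero on a space of dimension `k + 1`, the points of any finite set lie in the
relative interiors of at most `3 * (3 * #S) ^ k` simplicial cones not crossed by the arrangement. -/
theorem exists_cone_decomposition (k : ℕ) : ∀ (E : Type u) [AddCommGroup E] [Module ℝ E],
    Module.finrank ℝ E = k + 1 → ∀ S : Finset (Module.Dual ℝ E),
    (∀ x, (∀ f ∈ S, f x = 0) → x = 0) → ∀ U : Finset E,
    ∃ X : E → Fin (k + 1) → E, (∀ p ∈ U, IsConeAround S p (X p)) ∧
      Set.ncard (X '' U) ≤ 3 * (3 * S.card) ^ k := by
  induction k with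
  | zero =>
    intro E _ _ hE S _ U
    simpa using exists_cone_decomposition_line hE S U
  | succ k ih =>
    intro E _ _ hE S hS U
    refine exists_cone_decomposition_step hE S hS U fun f _ hf0 W => ?_
    have : FiniteDimensional ℝ E := Module.finite_of_finrank_pos (by omega)
    refine exists_cone_decomposition_ker S hS W f (ih _ ?_)
    have h1 := LinearMap.finrank_range_add_finrank_ker f
    rw [LinearMap.range_eq_top.2 (LinearMap.surjective hf0), finrank_top,
      Module.finrank_self, hE] at h1
    omega

/-! ### Hitting sets, VC dimension and the cutting lemma -/

open Finset

/-- **Greedy hitting set.** -/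
theorem exists_hitting_set_step {α : Type*} [DecidableEq α] (A : Finset α)
    (𝒦 : Finset (Finset α)) (δ : ℝ) (hK : ∀ K ∈ 𝒦, K ⊆ A ∧ δ * #A ≤ #K)
    (hA : A.Nonempty) (j : ℕ) : ∃ S ⊆ A, #S ≤ j ∧
      (#{K ∈ 𝒦 | Disjoint K S} : ℝ) ≤ Real.exp (-δ * j) * #𝒦 := by
  induction j with
  | zero => exact ⟨∅, by simp, by simp, by simp⟩
  | succ j ih =>
    obtain ⟨S, hSA, hSj, hS⟩ := ih
    set 𝒰 := {K ∈ 𝒦 | Disjoint K S} with h𝒰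
    have hcount : ∑ a ∈ A, (#{K ∈ 𝒰 | a ∈ K} : ℝ) = ∑ K ∈ 𝒰, (#K : ℝ) := by
      have := Finset.sum_card_bipartiteAbove_eq_sum_card_bipartiteBelow
        (s := A) (t := 𝒰) (fun a K => a ∈ K)
      have h2 : ∀ K ∈ 𝒰, A.bipartiteBelow (fun a K => a ∈ K) K = K := by
        intro K hKU
        ext a
        simp only [Finset.bipartiteBelow, Finset.mem_filter]
        exact ⟨fun h => h.2, fun h => ⟨(hK K (Finset.mem_filter.1 hKU).1).1 h, h⟩⟩
      rw [Finset.sum_congr rfl fun K hK => congrArg card (h2 K hK)] at this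
      exact_mod_cast this
    have hlow : ∑ a ∈ A, δ * (#𝒰 : ℝ) ≤ ∑ a ∈ A, (#{K ∈ 𝒰 | a ∈ K} : ℝ) := by
      rw [hcount]
      calc ∑ a ∈ A, δ * (#𝒰 : ℝ) = ∑ K ∈ 𝒰, δ * #A := by simp; ring
        _ ≤ _ := Finset.sum_le_sum fun K hKU => (hK K (Finset.mem_filter.1 hKU).1).2
    -- By averaging, some `a` lies in at least a proportion `δ` of the sets not yet hit.
    obtain ⟨a, ha, haU⟩ := Finset.exists_le_of_sum_le hA hlow
    refine ⟨insert a S, Finset.insert_subset ha hSA, (Finset.card_insert_le _ _).trans (by omega),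
      ?_⟩
    have hsplit : (#{K ∈ 𝒦 | Disjoint K (insert a S)} : ℝ) = #𝒰 - #{K ∈ 𝒰 | a ∈ K} := by
      have h1 : ({K ∈ 𝒦 | Disjoint K (insert a S)} : Finset _) = {K ∈ 𝒰 | ¬ a ∈ K} := by
        ext K; simp [h𝒰, Finset.disjoint_insert_right]; tauto
      rw [h1, ← Finset.card_filter_add_card_filter_not (s := 𝒰) (fun K => a ∈ K)]
      push_cast; ring
    rw [hsplit]
    have hexp : 1 - δ ≤ Real.exp (-δ) := by linarith [Real.add_one_le_exp (-δ)]
    calc (#𝒰 : ℝ) - #{K ∈ 𝒰 | a ∈ K} ≤ (1 - δ) * #𝒰 := by linarith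
      _ ≤ Real.exp (-δ) * #𝒰 := by gcongr
      _ ≤ Real.exp (-δ) * (Real.exp (-δ * j) * #𝒦) := by gcongr
      _ = Real.exp (-δ * (j + 1 : ℕ)) * #𝒦 := by
          rw [← mul_assoc, ← Real.exp_add]; congr 2; push_cast; ring

/-- With density `L / s`, after `s` greedy steps at most `exp (-L) * #𝒦 < 1` sets are missed. -/
theorem exists_hitting_set {α : Type*} [DecidableEq α] (A : Finset α) (hA : A.Nonempty)
    (𝒦 : Finset (Finset α)) (s : ℕ) (hs : 0 < s) (L : ℝ) (hL : Real.log #𝒦 < L)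
    (hK : ∀ K ∈ 𝒦, K ⊆ A ∧ L / s * #A ≤ #K) :
    ∃ S ⊆ A, #S ≤ s ∧ ∀ K ∈ 𝒦, ¬ Disjoint K S := by
  have hs' : (0 : ℝ) < s := by exact_mod_cast hs
  obtain ⟨S, h1, h2, h3⟩ := exists_hitting_set_step A 𝒦 (L / s) hK hA s
  refine ⟨S, h1, h2, fun K hKm hd => ?_⟩
  have hpos : (0 : ℝ) < #𝒦 := by exact_mod_cast Finset.card_pos.2 ⟨K, hKm⟩
  have hone : (1 : ℝ) ≤ #{K ∈ 𝒦 | Disjoint K S} := by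
    exact_mod_cast Finset.card_pos.2 ⟨K, Finset.mem_filter.2 ⟨hKm, hd⟩⟩
  have hlt : Real.exp (-(L / s) * s) * #𝒦 < 1 := by
    rw [← Real.exp_log hpos, ← Real.exp_add, Real.exp_lt_one_iff]
    field_simp
    linarith
  linarith

/-- Positivity patterns of `n` functionals on a `d`-dimensional space: the family of sets of
functionals positive at some point has VC dimension at most `d`. -/
theorem card_positivity_patterns_le {E α : Type*} [AddCommGroup E] [Module ℝ E]
    [FiniteDimensional ℝ E] [Fintype α] [DecidableEq α] (f : α → Module.Dual ℝ E)
    (ℱ : Finset (Finset α)) (hℱ : ∀ P ∈ ℱ, ∃ x : E, ∀ a, a ∈ P ↔ 0 < f a x) :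
    #ℱ ≤ (Fintype.card α + 1) ^ Module.finrank ℝ E := by
  have hvc : ℱ.vcDim ≤ Module.finrank ℝ E := by
    refine Finset.sup_le fun T hT => ?_
    by_contra! hlt
    have hsh := Finset.mem_shatterer.1 hT
    have hdep : ¬ LinearIndependent ℝ fun a : T => f a := by
      intro hli
      have := hli.fintype_card_le_finrank
      rw [Subspace.dual_finrank_eq, Fintype.card_coe] at this
      omega
    rw [Fintype.linearIndependent_iff] at hdep
    push Not at hdep
    -- Shattering yields a point `x` where exactly the functionals of `T` with positive coefficient
    -- are positive. All terms `c b * f b x` are then nonnegative and one is positive, against the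
    -- relation.
    have key : ∀ c : T → ℝ, ∑ a, c a • f a = 0 → ∀ a, ¬ 0 < c a := by
      intro c hc a ha
      obtain ⟨P, hP, hPT⟩ := hsh (Finset.filter_subset (fun b => ∃ hb : b ∈ T, 0 < c ⟨b, hb⟩) T)
      obtain ⟨x, hx⟩ := hℱ P hP
      have hmem : ∀ b : T, 0 < f b x ↔ 0 < c b := by
        intro b
        rw [← hx]
        have := congrArg ((b : α) ∈ ·) hPT
        simpa [b.2] using this
      have h0 : ∑ b, c b * f b x = 0 := by
        have := congrArg (fun g : Module.Dual ℝ E => g x) hc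
        simpa [LinearMap.sum_apply] using this
      have hpos : 0 < ∑ b, c b * f b x := by
        refine Finset.sum_pos' (fun b _ => ?_) ⟨a, Finset.mem_univ _, mul_pos ha ((hmem a).2 ha)⟩
        by_cases hb : 0 < c b
        · exact (mul_pos hb ((hmem b).2 hb)).le
        · exact mul_nonneg_of_nonpos_of_nonpos (not_lt.1 hb) (not_lt.1 (mt (hmem b).1 hb))
      exact hpos.ne' h0
    obtain ⟨c, hc, a, ha⟩ := hdep
    rcases lt_or_gt_of_ne ha with h | h
    · have hneg : ∑ b : T, (-c b) • f b = -∑ b : T, c b • f b := by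
        rw [← Finset.sum_neg_distrib]
        exact Finset.sum_congr rfl fun b _ => neg_smul (c b) (f b)
      exact key (fun b => -c b) (hneg.trans (by rw [hc, neg_zero])) a (by simpa using h)
    · exact key c hc a h
  calc #ℱ ≤ #ℱ.shatterer := Finset.card_le_card_shatterer ℱ
    _ ≤ ∑ k ∈ Finset.Iic ℱ.vcDim, (Fintype.card α).choose k := Finset.card_shatterer_le_sum_vcDim
    _ ≤ ∑ k ∈ Finset.Iic (Module.finrank ℝ E), (Fintype.card α).choose k :=
        Finset.sum_le_sum_of_subset (Finset.Iic_subset_Iic.2 hvc)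
    _ ≤ ∑ k ∈ Finset.range (Module.finrank ℝ E + 1),
          Fintype.card α ^ k * (Module.finrank ℝ E).choose k := by
        rw [← Nat.range_succ_eq_Iic]
        refine Finset.sum_le_sum fun k hk => ?_
        calc _ ≤ Fintype.card α ^ k := Nat.choose_le_pow _ _
          _ ≤ _ := Nat.le_mul_of_pos_right _
            (Nat.choose_pos (Nat.lt_succ_iff.1 (Finset.mem_range.1 hk)))
    _ = _ := by rw [add_pow]; simp

/-- The functionals taking both signs on the cone spanned by `X`. -/
noncomputable def crossing {E α : Type*} [AddCommGroup E] [Module ℝ E] [Fintype α]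
    (f : α → Module.Dual ℝ E) {d : ℕ} (X : Fin d → E) : Finset α := by
  classical exact {a | (∃ i, 0 < f a (X i)) ∧ ∃ i, f a (X i) < 0}

theorem mem_crossing {E α : Type*} [AddCommGroup E] [Module ℝ E] [Fintype α]
    {f : α → Module.Dual ℝ E} {d : ℕ} {X : Fin d → E} {a : α} :
    a ∈ crossing f X ↔ (∃ i, 0 < f a (X i)) ∧ ∃ i, f a (X i) < 0 := by
  classical simp [crossing]

/-- A crossing set is determined by `2 * d` positivity patterns, those at the points `X i` and `-X
i`. -/
theorem card_crossing_family_le {E α : Type*} [AddCommGroup E] [Module ℝ E]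
    [FiniteDimensional ℝ E] [Fintype α] [DecidableEq α] (f : α → Module.Dual ℝ E) (d : ℕ)
    (𝒦 : Finset (Finset α)) (h𝒦 : ∀ K ∈ 𝒦, ∃ X : Fin d → E, K = crossing f X) :
    #𝒦 ≤ (Fintype.card α + 1) ^ (Module.finrank ℝ E * d * 2) := by
  classical
  let ℱ : Finset (Finset α) := {P | ∃ x : E, ∀ a, a ∈ P ↔ 0 < f a x}
  have hℱ : #ℱ ≤ (Fintype.card α + 1) ^ Module.finrank ℝ E :=
    card_positivity_patterns_le f ℱ fun P hP => (Finset.mem_filter.1 hP).2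
  have hsub : 𝒦 ⊆ ((Fintype.piFinset fun _ : Fin d => ℱ) ×ˢ
      Fintype.piFinset fun _ : Fin d => ℱ).image fun z => univ.biUnion z.1 ∩ univ.biUnion z.2 := by
    intro K hK
    obtain ⟨X, rfl⟩ := h𝒦 K hK
    refine Finset.mem_image.2 ⟨(fun i => {a | 0 < f a (X i)}, fun i => {a | f a (X i) < 0}),
      ?_, ?_⟩
    · simp only [Finset.mem_product, Fintype.mem_piFinset]
      refine ⟨fun i => ?_, fun i => ?_⟩
      · simp only [ℱ, Finset.mem_filter, Finset.mem_univ, true_and]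
        exact ⟨X i, fun a => Iff.rfl⟩
      · simp only [ℱ, Finset.mem_filter, Finset.mem_univ, true_and]
        exact ⟨-X i, fun a => by simp⟩
    · ext a
      simp [mem_crossing]
  calc #𝒦 ≤ _ := (Finset.card_le_card hsub).trans Finset.card_image_le
    _ = (#ℱ ^ d) ^ 2 := by simp [Finset.card_product, sq]
    _ ≤ (((Fintype.card α + 1) ^ Module.finrank ℝ E) ^ d) ^ 2 := by gcongr
    _ = _ := by rw [pow_mul, pow_mul]

/-- **Cutting lemma.** A finite family of points of a space of dimension `k + 1` can be split into
`O (s ^ k)` classes, such that for each class only `O (n * log n / s)` of the `n` given hyperplanes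
meet the class without containing it. -/
theorem exists_cutting {E α ι : Type*} [AddCommGroup E] [Module ℝ E] {k : ℕ}
    (hE : Module.finrank ℝ E = k + 1) [Fintype α] [Nonempty α] [Fintype ι]
    (f : α → Module.Dual ℝ E) (p : ι → E) (s : ℕ) (hs : 0 < s) :
    ∃ ℓ : ι → Fin (k + 1) → E, Set.ncard (Set.range ℓ) ≤ 3 * (3 * (s + (k + 1))) ^ k ∧
      ∀ X, Set.ncard {a | (∃ v, ℓ v = X ∧ f a (p v) = 0) ∧ ∃ v, ℓ v = X ∧ f a (p v) ≠ 0} ≤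
        (2 * (k + 1) ^ 2 + 1) * Real.log (Fintype.card α + 1) / s * Fintype.card α := by
  classical
  have : FiniteDimensional ℝ E := Module.finite_of_finrank_pos (by omega)
  set L : ℝ := (2 * (k + 1) ^ 2 + 1) * Real.log (Fintype.card α + 1) with hL
  have hlog : 0 < Real.log (Fintype.card α + 1) := by
    apply Real.log_pos
    have : (0 : ℝ) < Fintype.card α := by exact_mod_cast Fintype.card_pos
    linarith
  let 𝒦 : Finset (Finset α) :=
    {K | (∃ X : Fin (k + 1) → E, K = crossing f X) ∧ L / s * Fintype.card α ≤ #K}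
  have h𝒦 : Real.log #𝒦 < L := by
    rcases Nat.eq_zero_or_pos #𝒦 with h0 | h0
    · rw [h0, Nat.cast_zero, Real.log_zero]; positivity
    have h1 : (#𝒦 : ℝ) ≤ ((Fintype.card α : ℝ) + 1) ^ ((k + 1) * (k + 1) * 2) := by
      have := card_crossing_family_le f (k + 1) 𝒦 fun K hK => (Finset.mem_filter.1 hK).2.1
      rw [hE] at this
      exact_mod_cast this
    calc Real.log #𝒦 ≤ Real.log (((Fintype.card α : ℝ) + 1) ^ ((k + 1) * (k + 1) * 2)) :=
          Real.log_le_log (by exact_mod_cast h0) h1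
      _ = (2 * (k + 1) ^ 2) * Real.log (Fintype.card α + 1) := by
          rw [Real.log_pow]; push_cast; ring
      _ < L := by rw [hL]; linarith
  obtain ⟨S, -, hSs, hS⟩ := exists_hitting_set (univ : Finset α) univ_nonempty 𝒦 s hs L h𝒦
    (fun K hK => ⟨subset_univ _, by simpa using (Finset.mem_filter.1 hK).2.2⟩)
  let b := Module.finBasisOfFinrankEq ℝ E hE
  -- The coordinate functionals ensure that there is no common zero.
  let T : Finset (Module.Dual ℝ E) := S.image f ∪ univ.image b.coord
  have hT : #T ≤ s + (k + 1) := by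
    refine (Finset.card_union_le _ _).trans (Nat.add_le_add (card_image_le.trans hSs) ?_)
    exact card_image_le.trans (by simp)
  obtain ⟨X, hX, hXcard⟩ := exists_cone_decomposition k E hE T (by
    intro x hx
    refine b.forall_coord_eq_zero_iff.1 fun i => hx _ ?_
    exact Finset.mem_union_right _ (Finset.mem_image_of_mem _ (mem_univ i))) (univ.image p)
  refine ⟨fun v => X (p v), ?_, fun Z => ?_⟩
  · have hsub : Set.range (fun v => X (p v)) ⊆ X '' (univ.image p : Finset E) := by
      rintro _ ⟨v, rfl⟩
      exact ⟨p v, by simp, rfl⟩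
    calc _ ≤ _ := Set.ncard_le_ncard hsub ((Finset.finite_toSet _).image _)
      _ ≤ _ := hXcard
      _ ≤ _ := by gcongr
  by_contra! hlt
  have hcone : ∀ v, IsConeAround T (p v) (X (p v)) := fun v => hX _ (by simp)
  -- A functional of constant sign on the cone that vanishes at one interior point vanishes on the
  -- whole class, so those splitting the class must cross the cone.
  have hsub : {a | (∃ v, X (p v) = Z ∧ f a (p v) = 0) ∧ ∃ v, X (p v) = Z ∧ f a (p v) ≠ 0} ⊆
      (crossing f Z : Set α) := by
    rintro a ⟨⟨v, hv, hav⟩, v', hv', hav'⟩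
    by_contra hcr
    rw [Finset.mem_coe, mem_crossing] at hcr
    have hsign : (∀ i, 0 ≤ f a (Z i)) ∨ (∀ i, f a (Z i) ≤ 0) := by
      by_contra! h
      exact hcr ⟨h.2, h.1⟩
    obtain ⟨⟨w, hw, hp⟩, -⟩ := hcone v
    obtain ⟨⟨w', hw', hp'⟩, -⟩ := hcone v'
    rw [hv] at hp
    rw [hv'] at hp'
    have hz := eq_zero_of_sum_eq_zero hw hsign (hp ▸ hav)
    apply hav'
    rw [hp']
    simp [hz]
  have hbig : L / s * Fintype.card α ≤ #(crossing f Z) := by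
    refine hlt.le.trans ?_
    have := Set.ncard_le_ncard hsub (Finset.finite_toSet _)
    rw [Set.ncard_coe_finset] at this
    exact_mod_cast this
  have hmem : crossing f Z ∈ 𝒦 := Finset.mem_filter.2 ⟨mem_univ _, ⟨Z, rfl⟩, hbig⟩
  -- The hitting set now supplies a member of `T` crossing a cone that `T` does not cross.
  obtain ⟨c, hc, hcS⟩ := Finset.not_disjoint_iff.1 (hS _ hmem)
  have hne : Set.Nonempty {a | (∃ v, X (p v) = Z ∧ f a (p v) = 0) ∧
      ∃ v, X (p v) = Z ∧ f a (p v) ≠ 0} := by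
    refine Set.nonempty_of_ncard_ne_zero fun h0 => ?_
    rw [h0, Nat.cast_zero] at hlt
    exact absurd hlt (not_lt.2 (by positivity))
  obtain ⟨-, ⟨v, hv, -⟩, -⟩ := hne
  obtain ⟨⟨i, hi⟩, j, hj⟩ := mem_crossing.1 hc
  rw [← hv] at hi hj
  rcases (hcone v).2 (f c) (Finset.mem_union_left _ (Finset.mem_image_of_mem _ hcS)) with h | h
  · exact absurd (h j) (not_le.2 hj)
  · exact absurd (h i) (not_le.2 hi)

/-! ### Incidence counting and rich points -/

/-- In a set of more than `4 * B` neighbours of `a`, a positive proportion of the triples is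
independent. -/
theorem card_cube_le_independent_triples {ι : Type*} [DecidableEq ι] (K : Finset ι)
    (Ind : ι → ι → ι → Prop) [∀ x y z, Decidable (Ind x y z)] (B : ℝ) (hB : 1 ≤ B)
    (h2 : ∀ v₁ ∈ K, ∀ v₂ ∈ K, v₁ ≠ v₂ → (#{v ∈ K | ¬ Ind v₁ v₂ v} : ℝ) ≤ B)
    (hK : 4 * B < #K) :
    (#K : ℝ) ^ 3 ≤ 4 * #{z ∈ K ×ˢ K ×ˢ K | Ind z.1 z.2.1 z.2.2} := by
  have hcard : (#{z ∈ K ×ˢ K ×ˢ K | Ind z.1 z.2.1 z.2.2} : ℝ) =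
      ∑ v₁ ∈ K, ∑ v₂ ∈ K, (#{v ∈ K | Ind v₁ v₂ v} : ℝ) := by
    simp only [Finset.card_filter, Finset.sum_product]
    push_cast
    rfl
  rw [hcard]
  have hlow : ∀ v₁ ∈ K, ((#K : ℝ) - 1) * (#K - B) ≤ ∑ v₂ ∈ K, (#{v ∈ K | Ind v₁ v₂ v} : ℝ) := by
    intro v₁ hv₁
    calc ((#K : ℝ) - 1) * (#K - B) = ∑ v₂ ∈ K.erase v₁, ((#K : ℝ) - B) := by
          rw [Finset.sum_const, Finset.card_erase_of_mem hv₁, nsmul_eq_mul,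
            Nat.cast_sub (Finset.card_pos.2 ⟨v₁, hv₁⟩)]
          simp
      _ ≤ ∑ v₂ ∈ K.erase v₁, (#{v ∈ K | Ind v₁ v₂ v} : ℝ) := by
          refine Finset.sum_le_sum fun v₂ hv₂ => ?_
          have h := h2 v₁ hv₁ v₂ (Finset.mem_of_mem_erase hv₂) (Finset.ne_of_mem_erase hv₂).symm
          have hs : (#{v ∈ K | Ind v₁ v₂ v} : ℝ) + #{v ∈ K | ¬ Ind v₁ v₂ v} = #K := by
            exact_mod_cast Finset.card_filter_add_card_filter_not _
          linarith
      _ ≤ _ := Finset.sum_le_sum_of_subset_of_nonneg (Finset.erase_subset _ _)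
          fun _ _ _ => by positivity
  have hsum : (#K : ℝ) * ((#K - 1) * (#K - B)) ≤
      ∑ v₁ ∈ K, ∑ v₂ ∈ K, (#{v ∈ K | Ind v₁ v₂ v} : ℝ) := by
    have := Finset.sum_le_sum hlow
    simpa using this
  have e1 : (#K : ℝ) / 2 ≤ #K - 1 := by linarith
  have e2 : (#K : ℝ) / 2 ≤ #K - B := by linarith
  have e3 : (#K : ℝ) / 2 * (#K / 2) ≤ (#K - 1) * (#K - B) :=
    mul_le_mul e1 e2 (by positivity) (by linarith)
  have e4 := mul_le_mul_of_nonneg_left e3 (Nat.cast_nonneg (α := ℝ) #K)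
  nlinarith

/-- **Kővári–Sós–Turán** count for a relation in which independent triples have few common
neighbours. -/
theorem sum_degrees_le_of_triples {α ι : Type*} [DecidableEq ι] [Fintype α]
    (R : α → ι → Prop) [∀ a v, Decidable (R a v)]
    (Ind : ι → ι → ι → Prop) [∀ x y z, Decidable (Ind x y z)] (B : ℝ) (hB : 1 ≤ B) (Q : Finset ι)
    (h1 : ∀ v₁ ∈ Q, ∀ v₂ ∈ Q, ∀ v₃ ∈ Q, Ind v₁ v₂ v₃ →
      (#{a | R a v₁ ∧ R a v₂ ∧ R a v₃} : ℝ) ≤ B)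
    (h2 : ∀ a, ∀ v₁ ∈ Q, ∀ v₂ ∈ Q, v₁ ≠ v₂ → R a v₁ → R a v₂ →
      (#{v ∈ Q | R a v ∧ ¬ Ind v₁ v₂ v} : ℝ) ≤ B)
    (A : Finset α) (y : ℝ) (hy : 0 < y) :
    ∑ a ∈ A, (#{v ∈ Q | R a v} : ℝ) ≤ #A * (4 * B + y) + 4 * B * (#Q : ℝ) ^ 3 / y ^ 2 := by
  let T : α → Finset (ι × ι × ι) := fun a =>
    {z ∈ ({v ∈ Q | R a v} : Finset ι) ×ˢ ({v ∈ Q | R a v} : Finset ι) ×ˢ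
      ({v ∈ Q | R a v} : Finset ι) | Ind z.1 z.2.1 z.2.2}
  -- Degrees up to `4 * B` or up to `y` go into the first term; a larger degree `κ` satisfies `κ * y
  -- ^ 2 ≤ κ ^ 3 ≤ 4 * #(T a)`.
  have hpoint : ∀ a ∈ A, (#{v ∈ Q | R a v} : ℝ) ≤ (4 * B + y) + 4 / y ^ 2 * #(T a) := by
    intro a _
    set κ : ℝ := (#{v ∈ Q | R a v} : ℝ) with hκ
    have hκ0 : 0 ≤ κ := Nat.cast_nonneg _
    by_cases hbig : 4 * B < κ
    · have h3 : κ ^ 3 ≤ 4 * #(T a) := by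
        refine card_cube_le_independent_triples _ Ind B hB ?_ hbig
        intro v₁ hv₁ v₂ hv₂ hne
        rw [Finset.filter_filter]
        rw [Finset.mem_filter] at hv₁ hv₂
        exact h2 a v₁ hv₁.1 v₂ hv₂.1 hne hv₁.2 hv₂.2
      by_cases hky : κ ≤ y
      · have : 0 ≤ 4 / y ^ 2 * (#(T a) : ℝ) := by positivity
        linarith
      · have h4 : κ * y ^ 2 ≤ κ ^ 3 := by
          have : y ^ 2 ≤ κ ^ 2 := by gcongr; linarith
          nlinarith
        have h5 : κ ≤ 4 / y ^ 2 * #(T a) := by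
          rw [div_mul_eq_mul_div, le_div_iff₀ (by positivity)]
          linarith
        linarith
    · have : 0 ≤ 4 / y ^ 2 * (#(T a) : ℝ) := by positivity
      linarith
  have hT : ∑ a ∈ A, (#(T a) : ℝ) ≤ B * (#Q : ℝ) ^ 3 := by
    let R' : α → ι × ι × ι → Prop := fun a z => (R a z.1 ∧ R a z.2.1 ∧ R a z.2.2) ∧
      Ind z.1 z.2.1 z.2.2
    have hd := Finset.sum_card_bipartiteAbove_eq_sum_card_bipartiteBelow
      (s := A) (t := Q ×ˢ Q ×ˢ Q) R'
    have hTa : ∀ a, T a = (Q ×ˢ Q ×ˢ Q).bipartiteAbove R' a := by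
      intro a
      ext ⟨x, y, z⟩
      simp only [T, R', Finset.bipartiteAbove, Finset.mem_filter, Finset.mem_product]
      tauto
    calc ∑ a ∈ A, (#(T a) : ℝ) = ∑ z ∈ Q ×ˢ Q ×ˢ Q, (#(A.bipartiteBelow R' z) : ℝ) := by
          simp only [hTa]
          exact_mod_cast hd
      _ ≤ ∑ z ∈ Q ×ˢ Q ×ˢ Q, B := by
          refine Finset.sum_le_sum fun z hz => ?_
          simp only [Finset.mem_product] at hz
          by_cases hI : Ind z.1 z.2.1 z.2.2
          · refine le_trans ?_ (h1 _ hz.1 _ hz.2.1 _ hz.2.2 hI)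
            exact_mod_cast Finset.card_le_card fun a ha => by
              simp only [Finset.bipartiteBelow, Finset.mem_filter, R'] at ha
              simpa using ha.2.1
          · have : A.bipartiteBelow R' z = ∅ := by
              simp [Finset.bipartiteBelow, R', hI]
            rw [this]
            simp
            linarith
      _ = B * (#Q : ℝ) ^ 3 := by
          simp [Finset.card_product]; ring
  calc ∑ a ∈ A, (#{v ∈ Q | R a v} : ℝ)
      ≤ ∑ a ∈ A, ((4 * B + y) + 4 / y ^ 2 * #(T a)) := Finset.sum_le_sum hpoint
    _ = #A * (4 * B + y) + 4 / y ^ 2 * ∑ a ∈ A, (#(T a) : ℝ) := by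
        rw [Finset.sum_add_distrib, Finset.mul_sum]; simp; ring
    _ ≤ #A * (4 * B + y) + 4 / y ^ 2 * (B * (#Q : ℝ) ^ 3) := by gcongr
    _ = _ := by ring

/-- A class of `k`-rich elements is small once few neighbours see only a part of it. -/
theorem card_class_le {α ι : Type*} [DecidableEq ι] [Fintype α]
    (R : α → ι → Prop) [∀ a v, Decidable (R a v)]
    (Ind : ι → ι → ι → Prop) [∀ x y z, Decidable (Ind x y z)] (B : ℝ) (hB : 1 ≤ B) (Q : Finset ι)
    (h1 : ∀ v₁ ∈ Q, ∀ v₂ ∈ Q, ∀ v₃ ∈ Q, Ind v₁ v₂ v₃ →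
      (#{a | R a v₁ ∧ R a v₂ ∧ R a v₃} : ℝ) ≤ B)
    (h2 : ∀ a, ∀ v₁ ∈ Q, ∀ v₂ ∈ Q, v₁ ≠ v₂ → R a v₁ → R a v₂ →
      (#{v ∈ Q | R a v ∧ ¬ Ind v₁ v₂ v} : ℝ) ≤ B)
    (k : ℝ) (hk : 4 * B ≤ k) (hrich : ∀ v ∈ Q, k ≤ #{a | R a v})
    (h : ℝ) (hh : 0 < h) (hpart : (#{a | (∃ v ∈ Q, R a v) ∧ ∃ v ∈ Q, ¬ R a v} : ℝ) ≤ h)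
    (hkh : 4096 * B * h ^ 2 ≤ k ^ 3) :
    (#Q : ℝ) ≤ 3 * B + 16 * B * h / k := by
  classical
  have hk0 : 0 < k := by linarith
  by_contra! hlt
  have hQ3 : 3 * B < #Q := by
    have : 0 ≤ 16 * B * h / k := by positivity
    linarith
  have hQ0 : (0 : ℝ) < #Q := by linarith
  set A₁ : Finset α := {a | ∀ v ∈ Q, R a v} with hA₁
  set A₂ : Finset α := {a | (∃ v ∈ Q, R a v) ∧ ∃ v ∈ Q, ¬ R a v} with hA₂
  -- If some `a` sees all of `Q`, then `#Q > B` forces an independent triple in `Q`, which has at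
  -- most `B` common neighbours.
  have hfull : (#A₁ : ℝ) ≤ B := by
    rcases A₁.eq_empty_or_nonempty with h0 | ⟨a, ha⟩
    · rw [h0]; simp; linarith
    · have ha' := (Finset.mem_filter.1 ha).2
      have hone : 1 < #Q := by
        have : (1 : ℝ) < #Q := by linarith
        exact_mod_cast this
      obtain ⟨v₁, hv₁, v₂, hv₂, hne⟩ := Finset.one_lt_card.1 hone
      have hb := h2 a v₁ hv₁ v₂ hv₂ hne (ha' _ hv₁) (ha' _ hv₂)
      obtain ⟨v₃, hv₃, hI⟩ : ∃ v ∈ Q, Ind v₁ v₂ v := by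
        by_contra! hc
        have : ({v ∈ Q | R a v ∧ ¬ Ind v₁ v₂ v} : Finset ι) = Q :=
          Finset.filter_true_of_mem fun v hv => ⟨ha' v hv, hc v hv⟩
        rw [this] at hb
        linarith
      refine le_trans ?_ (h1 v₁ hv₁ v₂ hv₂ v₃ hv₃ hI)
      exact_mod_cast Finset.card_le_card fun b hb => by
        have := (Finset.mem_filter.1 hb).2
        simp [this _ hv₁, this _ hv₂, this _ hv₃]
  have hcount : k * #Q ≤ ∑ a, (#{v ∈ Q | R a v} : ℝ) := by
    have hd := Finset.sum_card_bipartiteAbove_eq_sum_card_bipartiteBelow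
      (s := (univ : Finset α)) (t := Q) R
    calc k * #Q = ∑ v ∈ Q, k := by simp; ring
      _ ≤ ∑ v ∈ Q, (#{a | R a v} : ℝ) := Finset.sum_le_sum hrich
      _ = _ := by exact_mod_cast hd.symm
  have hsplit : ∑ a, (#{v ∈ Q | R a v} : ℝ) ≤
      ∑ a ∈ A₁, (#{v ∈ Q | R a v} : ℝ) + ∑ a ∈ A₂, (#{v ∈ Q | R a v} : ℝ) := by
    have hdisj : Disjoint A₁ A₂ := by
      rw [Finset.disjoint_left]
      intro a ha hb
      obtain ⟨-, v, hv, hn⟩ := (Finset.mem_filter.1 hb).2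
      exact hn ((Finset.mem_filter.1 ha).2 v hv)
    rw [← Finset.sum_union hdisj]
    refine le_of_eq (Finset.sum_subset (subset_univ _) ?_).symm
    intro a _ ha
    simp only [hA₁, hA₂, Finset.mem_union, Finset.mem_filter, Finset.mem_univ, true_and,
      not_or] at ha
    obtain ⟨hx, hy⟩ := ha
    push Not at hx
    have : ({v ∈ Q | R a v} : Finset ι) = ∅ :=
      Finset.filter_eq_empty_iff.2 fun v hv hR => hy ⟨⟨v, hv, hR⟩, hx⟩
    simp [this]
  have hs1 : ∑ a ∈ A₁, (#{v ∈ Q | R a v} : ℝ) ≤ B * #Q := by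
    calc _ ≤ ∑ a ∈ A₁, (#Q : ℝ) :=
          Finset.sum_le_sum fun a _ => by exact_mod_cast Finset.card_filter_le _ _
      _ = #A₁ * #Q := by simp
      _ ≤ _ := by gcongr
  -- This threshold `y` makes `h * y` equal to `#Q * k / 8`, and `hkh` bounds the cubic term by the
  -- same amount.
  have hs2 := sum_degrees_le_of_triples R Ind B hB Q h1 h2 A₂ (#Q * (k / (8 * h)))
    (by positivity)
  have hs2' : ∑ a ∈ A₂, (#{v ∈ Q | R a v} : ℝ) ≤ h * (4 * B + #Q * (k / (8 * h))) +
      4 * B * (#Q : ℝ) ^ 3 / (#Q * (k / (8 * h))) ^ 2 := hs2.trans (by gcongr)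
  have e1 : h * (4 * B + #Q * (k / (8 * h))) = 4 * B * h + #Q * (k / 8) := by field_simp
  have e2 : 4 * B * (#Q : ℝ) ^ 3 / (#Q * (k / (8 * h))) ^ 2 = #Q * (256 * B * h ^ 2 / k ^ 2) := by
    field_simp; ring
  have e3 : 256 * B * h ^ 2 / k ^ 2 ≤ k / 8 := by
    rw [div_le_iff₀ (by positivity)]
    have : 0 ≤ B * h ^ 2 := by positivity
    nlinarith
  have e4 : (#Q : ℝ) * (256 * B * h ^ 2 / k ^ 2) ≤ #Q * (k / 8) := by gcongr
  have e5 : 16 * B * h < #Q * k := by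
    have : 16 * B * h / k < #Q := by linarith
    rwa [div_lt_iff₀ hk0] at this
  have e6 : B * #Q ≤ k / 4 * #Q := by gcongr; linarith
  nlinarith

/-- Bound for the number of rich points in an incidence structure of points and linear hyperplanes
of a six-dimensional space, in terms of the cutting parameter `s`. -/
theorem card_rich_le_of_cutting {E α ι : Type*} [AddCommGroup E] [Module ℝ E]
    (hE : Module.finrank ℝ E = 6) [Fintype α] [Nonempty α] [Fintype ι]
    (f : α → Module.Dual ℝ E) (p : ι → E) (R : α → ι → Prop) [∀ a v, Decidable (R a v)]
    (hR : ∀ a v, R a v ↔ f a (p v) = 0)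
    (Ind : ι → ι → ι → Prop) [∀ x y z, Decidable (Ind x y z)] (B : ℝ) (hB : 1 ≤ B)
    (h1 : ∀ v₁ v₂ v₃, Ind v₁ v₂ v₃ → (#{a | R a v₁ ∧ R a v₂ ∧ R a v₃} : ℝ) ≤ B)
    (h2 : ∀ a v₁ v₂, v₁ ≠ v₂ → R a v₁ → R a v₂ → (#{v | R a v ∧ ¬ Ind v₁ v₂ v} : ℝ) ≤ B)
    (hlog : 73 * Real.log (Fintype.card α + 1) ≤ B)
    (k : ℝ) (hk : 4 * B ≤ k) (hrich : ∀ v, k ≤ #{a | R a v})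
    (s : ℕ) (hs : 0 < s) (hks : 4096 * B * (Fintype.card α * B / s) ^ 2 ≤ k ^ 3) :
    (Fintype.card ι : ℝ) ≤
      3 * (3 * (s + 6)) ^ 5 * (3 * B + 16 * B * (Fintype.card α * B / s) / k) := by
  classical
  have hn : (0 : ℝ) < Fintype.card α := by exact_mod_cast Fintype.card_pos
  have hs' : (0 : ℝ) < s := by exact_mod_cast hs
  have hk0 : 0 < k := by linarith
  obtain ⟨ℓ, hℓ, hcut⟩ := exists_cutting (k := 5) hE f p s hs
  have hclass : ∀ X, (#{v | ℓ v = X} : ℝ) ≤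
      3 * B + 16 * B * (Fintype.card α * B / s) / k := by
    intro X
    refine card_class_le R Ind B hB {v | ℓ v = X} (fun v₁ _ v₂ _ v₃ _ => h1 v₁ v₂ v₃) ?_ k hk
      (fun v _ => hrich v) _ (by positivity) ?_ hks
    · intro a v₁ _ v₂ _ hne hr₁ hr₂
      refine le_trans ?_ (h2 a v₁ v₂ hne hr₁ hr₂)
      exact_mod_cast Finset.card_le_card (Finset.filter_subset_filter _ (subset_univ _))
    · have h := hcut X
      have e : {a | (∃ v, ℓ v = X ∧ f a (p v) = 0) ∧ ∃ v, ℓ v = X ∧ f a (p v) ≠ 0} =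
          ((({a | (∃ v ∈ ({v | ℓ v = X} : Finset ι), R a v) ∧
            ∃ v ∈ ({v | ℓ v = X} : Finset ι), ¬ R a v} : Finset α)) : Set α) := by
        ext a
        simp [hR]
      rw [e, Set.ncard_coe_finset] at h
      refine h.trans ?_
      -- `73 = 2 * 6 ^ 2 + 1` is the cutting constant in dimension six.
      have hc : (2 * (((5 : ℕ) : ℝ) + 1) ^ 2 + 1) * Real.log (Fintype.card α + 1) ≤ B := by
        norm_num; linarith
      calc _ ≤ B / s * Fintype.card α := by gcongr
        _ = _ := by ring
  have hcardimg : (#(univ.image ℓ) : ℝ) ≤ 3 * (3 * (s + 6)) ^ 5 := by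
    have e : Set.range ℓ = ((univ.image ℓ : Finset _) : Set (Fin 6 → E)) := by simp
    rw [e, Set.ncard_coe_finset] at hℓ
    exact_mod_cast hℓ
  calc (Fintype.card ι : ℝ) = ∑ X ∈ univ.image ℓ, (#{v | ℓ v = X} : ℝ) := by
        rw [← Finset.card_univ, Finset.card_eq_sum_card_image ℓ univ]; push_cast; rfl
    _ ≤ ∑ X ∈ univ.image ℓ, (3 * B + 16 * B * (Fintype.card α * B / s) / k) :=
        Finset.sum_le_sum fun X _ => hclass X
    _ = #(univ.image ℓ) * (3 * B + 16 * B * (Fintype.card α * B / s) / k) := by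
        rw [Finset.sum_const, nsmul_eq_mul]
    _ ≤ _ := by gcongr

/-- Here `n = ν²` and `k = κ²`. Up to powers of `B`, the terms are `s⁵ k²` and `s⁴ n k` with `s`
about `y = max 1 (n / k^(3/2))`. When the maximum is the quotient, the second term is `n⁵ / k⁵`,
which equals `n^(5/2)` exactly at `k = √n`. -/
theorem rich_exponent_arithmetic {ν κ B s m : ℝ} (hB : 1 ≤ B) (hκ : 1 ≤ κ) (h1 : ν ≤ κ ^ 2)
    (h2 : κ ≤ ν) (hs1 : 1 ≤ s) (hs : s ≤ 64 * B ^ 2 * (ν ^ 2 / κ ^ 3) + 1)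
    (hm : m ≤ 3 * (3 * (s + 6)) ^ 5 * (3 * B + 16 * B * (ν ^ 2 * B / s) / κ ^ 2)) :
    m * (κ ^ 2) ^ 2 ≤ 57 * 21 ^ 5 * 65 ^ 5 * B ^ 11 * ν ^ 5 := by
  have hν : 1 ≤ ν := hκ.trans h2
  have hκ0 : 0 < κ := by linarith
  obtain ⟨y, hy1, hsy, hy5, hy4⟩ : ∃ y : ℝ, 1 ≤ y ∧ s ≤ 65 * B ^ 2 * y ∧ y ^ 5 * κ ^ 4 ≤ ν ^ 5 ∧
      y ^ 4 * ν ^ 2 * κ ^ 2 ≤ ν ^ 5 := by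
    have hB2 : 1 ≤ B ^ 2 := one_le_pow₀ hB
    have h5 : ν ^ 5 ≤ κ ^ 10 := by
      calc ν ^ 5 ≤ (κ ^ 2) ^ 5 := by gcongr
        _ = κ ^ 10 := by ring
    rcases le_total 1 (ν ^ 2 / κ ^ 3) with h | h
    · refine ⟨ν ^ 2 / κ ^ 3, h, ?_, ?_, ?_⟩
      · nlinarith
      · have e : (ν ^ 2 / κ ^ 3) ^ 5 * κ ^ 4 = ν ^ 5 * (ν ^ 5 / κ ^ 11) := by field_simp
        rw [e]
        refine mul_le_of_le_one_right (by positivity) ((div_le_one (by positivity)).2 ?_)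
        exact h5.trans (pow_le_pow_right₀ hκ (by norm_num))
      · have e : (ν ^ 2 / κ ^ 3) ^ 4 * ν ^ 2 * κ ^ 2 = ν ^ 5 * (ν ^ 5 / κ ^ 10) := by field_simp
        rw [e]
        exact mul_le_of_le_one_right (by positivity) ((div_le_one (by positivity)).2 h5)
    · refine ⟨1, le_rfl, ?_, ?_, ?_⟩
      · nlinarith
      · calc 1 ^ 5 * κ ^ 4 ≤ 1 ^ 5 * ν ^ 4 := by gcongr
          _ ≤ ν ^ 5 := by simpa using pow_le_pow_right₀ hν (by norm_num : 4 ≤ 5)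
      · calc 1 ^ 4 * ν ^ 2 * κ ^ 2 ≤ 1 ^ 4 * ν ^ 2 * ν ^ 2 := by gcongr
          _ = ν ^ 4 := by ring
          _ ≤ ν ^ 5 := pow_le_pow_right₀ hν (by norm_num)
  have hs0 : 0 < s := by linarith
  have hB0 : 0 < B := by linarith
  have hm' : m ≤ 3 * (21 * s) ^ 5 * (3 * B + 16 * B * (ν ^ 2 * B / s) / κ ^ 2) := by
    refine hm.trans ?_
    gcongr ?_ * ?_ ^ 5 * _
    linarith
  calc m * (κ ^ 2) ^ 2
      ≤ 3 * (21 * s) ^ 5 * (3 * B + 16 * B * (ν ^ 2 * B / s) / κ ^ 2) * (κ ^ 2) ^ 2 := by gcongr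
    _ = 3 * 21 ^ 5 * (3 * B * (s ^ 5 * κ ^ 4) + 16 * B ^ 2 * (s ^ 4 * ν ^ 2 * κ ^ 2)) := by
        field_simp
    _ ≤ 3 * 21 ^ 5 * (3 * B * ((65 * B ^ 2 * y) ^ 5 * κ ^ 4) +
          16 * B ^ 2 * ((65 * B ^ 2 * y) ^ 4 * ν ^ 2 * κ ^ 2)) := by gcongr
    _ = 3 * 21 ^ 5 * (3 * 65 ^ 5 * B ^ 11 * (y ^ 5 * κ ^ 4) +
          16 * 65 ^ 4 * B ^ 10 * (y ^ 4 * ν ^ 2 * κ ^ 2)) := by ring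
    _ ≤ 3 * 21 ^ 5 * (3 * 65 ^ 5 * B ^ 11 * ν ^ 5 + 16 * 65 ^ 5 * B ^ 11 * ν ^ 5) := by
        gcongr <;> norm_num
    _ = _ := by ring

/-- **Rich points.** In an incidence structure of points and linear hyperplanes of a
six-dimensional space in which independent triples of points lie on few common hyperplanes, the
number `m` of points on at least `k ≥ √n` of the `n` hyperplanes satisfies
`m * k ^ 2 = O (n ^ (5 / 2))`. -/
theorem card_rich_mul_sq_le {E α ι : Type*} [AddCommGroup E] [Module ℝ E]
    (hE : Module.finrank ℝ E = 6) [Fintype α] [Fintype ι]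
    (f : α → Module.Dual ℝ E) (p : ι → E) (R : α → ι → Prop) [∀ a v, Decidable (R a v)]
    (hR : ∀ a v, R a v ↔ f a (p v) = 0)
    (Ind : ι → ι → ι → Prop) [∀ x y z, Decidable (Ind x y z)] (B : ℝ) (hB : 1 ≤ B)
    (h1 : ∀ v₁ v₂ v₃, Ind v₁ v₂ v₃ → (#{a | R a v₁ ∧ R a v₂ ∧ R a v₃} : ℝ) ≤ B)
    (h2 : ∀ a v₁ v₂, v₁ ≠ v₂ → R a v₁ → R a v₂ → (#{v | R a v ∧ ¬ Ind v₁ v₂ v} : ℝ) ≤ B)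
    (hlog : 73 * Real.log (Fintype.card α + 1) ≤ B)
    (k : ℝ) (hk : 4 * B ≤ k) (hkn : √(Fintype.card α) ≤ k) (hrich : ∀ v, k ≤ #{a | R a v}) :
    (Fintype.card ι : ℝ) * k ^ 2 ≤
      57 * 21 ^ 5 * 65 ^ 5 * B ^ 11 * √(Fintype.card α) ^ 5 := by
  classical
  have hk0 : 0 < k := by linarith
  rcases isEmpty_or_nonempty ι with hι | ⟨⟨v₀⟩⟩
  · have : (Fintype.card ι : ℝ) = 0 := by simp
    rw [this, zero_mul]
    positivity
  have hkle : k ≤ Fintype.card α := (hrich v₀).trans (by exact_mod_cast Finset.card_le_univ _)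
  have hn : (0 : ℝ) < Fintype.card α := hk0.trans_le hkle
  have : Nonempty α := Fintype.card_pos_iff.1 (by exact_mod_cast hn)
  set ν := √(Fintype.card α : ℝ) with hν
  set κ := √k with hκ
  have hν2 : ν ^ 2 = Fintype.card α := Real.sq_sqrt hn.le
  have hκ2 : κ ^ 2 = k := Real.sq_sqrt hk0.le
  have hκ1 : 1 ≤ κ := Real.one_le_sqrt.2 (by linarith)
  -- Chosen so that `h = n * B / s` satisfies `64 * B * h ≤ κ ^ 3`, which gives the hypothesis of
  -- the class bound.
  set s : ℕ := ⌈64 * B ^ 2 * (ν ^ 2 / κ ^ 3)⌉₊ with hs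
  have hpos : 0 < 64 * B ^ 2 * (ν ^ 2 / κ ^ 3) := by
    rw [hν2]; positivity
  have hs0 : 0 < s := Nat.ceil_pos.2 hpos
  have hsle : 64 * B ^ 2 * (ν ^ 2 / κ ^ 3) ≤ s := Nat.le_ceil _
  have hs' : (0 : ℝ) < s := by exact_mod_cast hs0
  have hm := card_rich_le_of_cutting hE f p R hR Ind B hB h1 h2 hlog k hk hrich s hs0 (by
    rw [← hν2, ← hκ2]
    have hstep : 64 * B * (ν ^ 2 * B / s) ≤ κ ^ 3 := by
      have e : 64 * B * (ν ^ 2 * B / s) = 64 * B ^ 2 * (ν ^ 2 / κ ^ 3) / s * κ ^ 3 := by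
        field_simp
      rw [e]
      refine mul_le_of_le_one_left (by positivity) ((div_le_one hs').2 hsle)
    calc 4096 * B * (ν ^ 2 * B / s) ^ 2 ≤ 4096 * B ^ 2 * (ν ^ 2 * B / s) ^ 2 := by
          gcongr; nlinarith
      _ = (64 * B * (ν ^ 2 * B / s)) ^ 2 := by ring
      _ ≤ (κ ^ 3) ^ 2 := by gcongr
      _ = _ := by ring)
  rw [← hκ2]
  rw [← hν2, ← hκ2] at hm
  refine rich_exponent_arithmetic hB hκ1 (hκ2 ▸ hkn) ?_ (by exact_mod_cast hs0)
    (Nat.ceil_lt_add_one hpos.le).le hm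
  exact Real.sqrt_le_sqrt hkle

/-! ### Divisors and representations by `x² + D y²` -/

/-- **Divisor bound.** -/
theorem exists_card_divisors_le_rpow (ε : ℝ) (hε : 0 < ε) :
    ∃ C : ℝ, 1 ≤ C ∧ ∀ n : ℕ, n ≠ 0 → (#n.divisors : ℝ) ≤ C * (n : ℝ) ^ ε := by
  -- A prime `p ≥ P` has `p ^ ε ≥ 2`, so `a + 1 ≤ 2 ^ a ≤ (p ^ a) ^ ε`. Each smaller prime costs a
  -- factor `K`, whence `K ^ P`.
  obtain ⟨P, hP⟩ := exists_nat_ge ((2 : ℝ) ^ (1 / ε))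
  set K : ℝ := 1 + 1 / (ε * Real.log 2) with hK
  have hlog2 : 0 < Real.log 2 := Real.log_pos (by norm_num)
  have hK1 : 1 ≤ K := by
    have : 0 < 1 / (ε * Real.log 2) := by positivity
    linarith
  have hsmall : ∀ p a : ℕ, 2 ≤ p → (a + 1 : ℝ) ≤ K * ((p : ℝ) ^ a) ^ ε := by
    intro p a hp
    have hp' : (2 : ℝ) ≤ p := by exact_mod_cast hp
    have h2 : ((2 : ℝ) ^ a) ^ ε ≤ ((p : ℝ) ^ a) ^ ε := by gcongr
    have h3 : 1 + a * (ε * Real.log 2) ≤ ((2 : ℝ) ^ a) ^ ε := by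
      rw [Real.rpow_def_of_pos (by positivity), Real.log_pow]
      have := Real.add_one_le_exp ((a : ℝ) * Real.log 2 * ε)
      linarith
    have h4 : (a + 1 : ℝ) ≤ K * (1 + a * (ε * Real.log 2)) := by
      have e : K * (1 + a * (ε * Real.log 2)) =
          1 + a * (ε * Real.log 2) + 1 / (ε * Real.log 2) + a := by
        rw [hK]; field_simp; ring
      rw [e]
      have h5 : 0 ≤ (a : ℝ) * (ε * Real.log 2) := by positivity
      have h6 : 0 ≤ 1 / (ε * Real.log 2) := by positivity
      linarith
    calc (a + 1 : ℝ) ≤ K * (1 + a * (ε * Real.log 2)) := h4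
      _ ≤ K * ((p : ℝ) ^ a) ^ ε := by gcongr; exact h3.trans h2
  have hlarge : ∀ p a : ℕ, P ≤ p → (a + 1 : ℝ) ≤ ((p : ℝ) ^ a) ^ ε := by
    intro p a hp
    have hp' : (2 : ℝ) ^ (1 / ε) ≤ p := hP.trans (by exact_mod_cast hp)
    have h2 : (2 : ℝ) ≤ (p : ℝ) ^ ε := by
      calc (2 : ℝ) = ((2 : ℝ) ^ (1 / ε)) ^ ε := by
            rw [← Real.rpow_mul (by norm_num), one_div_mul_cancel hε.ne', Real.rpow_one]
        _ ≤ _ := by gcongr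
    calc (a + 1 : ℝ) ≤ 2 ^ a := by exact_mod_cast Nat.lt_two_pow_self
      _ ≤ ((p : ℝ) ^ ε) ^ a := by gcongr
      _ = ((p : ℝ) ^ a) ^ ε := by
        rw [← Real.rpow_natCast, ← Real.rpow_natCast, ← Real.rpow_mul (by positivity),
          ← Real.rpow_mul (by positivity), mul_comm]
  refine ⟨K ^ P, one_le_pow₀ hK1, fun n hn => ?_⟩
  have hprod : (n : ℝ) ^ ε = ∏ p ∈ n.primeFactors, ((p : ℝ) ^ n.factorization p) ^ ε := by
    rw [Real.finsetProd_rpow _ _ fun p _ => by positivity]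
    congr 1
    conv_lhs => rw [← Nat.prod_factorization_pow_eq_self hn]
    rw [Finsupp.prod]
    push_cast
    rfl
  have hP' : ∏ p ∈ n.primeFactors, (if p < P then K else 1) ≤ K ^ P := by
    rw [Finset.prod_ite, Finset.prod_const, Finset.prod_const_one, mul_one]
    refine pow_le_pow_right₀ hK1 ?_
    calc _ ≤ #(Finset.range P) := Finset.card_le_card fun p hp => by
            simpa using (Finset.mem_filter.1 hp).2
      _ = P := Finset.card_range P
  rw [Nat.card_divisors hn, hprod]
  push_cast
  calc ∏ p ∈ n.primeFactors, ((n.factorization p : ℝ) + 1)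
      ≤ ∏ p ∈ n.primeFactors, (if p < P then K else 1) * ((p : ℝ) ^ n.factorization p) ^ ε := by
        refine Finset.prod_le_prod (fun p _ => by positivity) fun p hp => ?_
        split_ifs with h
        · exact hsmall p _ (Nat.prime_of_mem_primeFactors hp).two_le
        · rw [one_mul]; exact hlarge p _ (not_lt.1 h)
    _ = (∏ p ∈ n.primeFactors, (if p < P then K else 1)) *
          ∏ p ∈ n.primeFactors, ((p : ℝ) ^ n.factorization p) ^ ε := Finset.prod_mul_distrib
    _ ≤ _ := by
        gcongr

theorem dvd_two_of_mul_self_dvd_four_mul {D h : ℕ} (hD : Squarefree D) (hh : h * h ∣ 4 * D) :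
    h ∣ 2 := by
  rcases Nat.even_or_odd' h with ⟨j, rfl | rfl⟩
  · have : j * j ∣ D := by
      refine Nat.dvd_of_mul_dvd_mul_left (by norm_num : 0 < 4) ?_
      convert hh using 1; ring
    rw [Nat.isUnit_iff.1 (hD j this)]
  · have hc : Nat.Coprime ((2 * j + 1) * (2 * j + 1)) 4 := by
      have h2 : Nat.Coprime (2 * j + 1) 2 := by simp
      have : Nat.Coprime (2 * j + 1) (2 ^ 2) := h2.pow_right 2
      exact Nat.Coprime.mul_left this this
    rw [Nat.isUnit_iff.1 (hD _ (hc.dvd_of_dvd_mul_left hh))]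
    norm_num

/-- Two primitive representations of `M` by `x² + D y²` that are congruent to a third one in the
same way are congruent to each other. -/
theorem dvd_two_mul_cross {D : ℕ} (hD : Squarefree D) {M x₀ y₀ x y x' y' : ℤ}
    (h₀ : x₀ ^ 2 + D * y₀ ^ 2 = M) (h : x ^ 2 + D * y ^ 2 = M) (h' : x' ^ 2 + D * y' ^ 2 = M)
    (c₀ : IsCoprime x₀ y₀) (c : IsCoprime x y)
    (hg : Int.gcd (x * y₀ - x₀ * y) M = Int.gcd (x' * y₀ - x₀ * y') M) :
    M ∣ 2 * (x * y' - x' * y) := by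
  have cop : ∀ {u v : ℤ}, u ^ 2 + D * v ^ 2 = M → IsCoprime u v → IsCoprime v M := by
    intro u v huv hc
    have : IsCoprime v (u ^ 2) := hc.symm.pow_right
    have := this.add_mul_left_right (D * v)
    have e : u ^ 2 + v * (D * v) = M := by rw [← huv]; ring
    rwa [e] at this
  have cy₀ := cop h₀ c₀
  have cy := cop h c
  set g : ℤ := (Int.gcd (x * y₀ - x₀ * y) M : ℤ) with hgdef
  obtain ⟨q, hq⟩ : g ∣ M := Int.gcd_dvd_right _ _
  rcases eq_or_ne g 0 with hg0 | hg0
  · have hM : M = 0 := by rw [hq, hg0, zero_mul]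
    have hx : x₀ ^ 2 + D * y₀ ^ 2 = 0 := h₀.trans hM
    have hD0 : (1 : ℤ) ≤ D := by exact_mod_cast Nat.pos_of_ne_zero hD.ne_zero
    have hy0 : y₀ = 0 := by
      by_contra hy
      have : 0 < y₀ ^ 2 := by positivity
      nlinarith [sq_nonneg x₀]
    have hx0 : x₀ = 0 := by simpa [hy0] using hx
    rw [hx0, hy0] at c₀
    exact absurd c₀ not_isCoprime_zero_zero
  -- The product of `u * y₀ - x₀ * v` and its conjugate `u * y₀ + x₀ * v` is a multiple of `M`, so
  -- the cofactor `q = M / g` divides the conjugate.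
  have hsum : ∀ {u v : ℤ}, u ^ 2 + D * v ^ 2 = M → g = (Int.gcd (u * y₀ - x₀ * v) M : ℤ) →
      q ∣ u * y₀ + x₀ * v := by
    intro u v huv hguv
    have hbez := Int.gcd_eq_gcd_ab (u * y₀ - x₀ * v) M
    rw [← hguv] at hbez
    refine (mul_dvd_mul_iff_left hg0).1 ?_
    rw [← hq]
    have e : (u * y₀ - x₀ * v) * (u * y₀ + x₀ * v) = M * (y₀ ^ 2 - v ^ 2) := by
      linear_combination y₀ ^ 2 * huv - v ^ 2 * h₀
    refine ⟨(y₀ ^ 2 - v ^ 2) * Int.gcdA (u * y₀ - x₀ * v) M +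
      Int.gcdB (u * y₀ - x₀ * v) M * (u * y₀ + x₀ * v), ?_⟩
    linear_combination (u * y₀ + x₀ * v) * hbez + Int.gcdA (u * y₀ - x₀ * v) M * e
  have hg' : g = (Int.gcd (x' * y₀ - x₀ * y') M : ℤ) := by rw [hgdef, hg]
  have q1 := hsum h rfl
  have q2 := hsum h' hg'
  have g1 : g ∣ x * y₀ - x₀ * y := Int.gcd_dvd_left _ _
  have g2 : g ∣ x' * y₀ - x₀ * y' := hg' ▸ Int.gcd_dvd_left _ _
  have hgM : g ∣ M := ⟨q, hq⟩
  have hqM : q ∣ M := ⟨g, by rw [hq]; ring⟩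
  have gR : g ∣ x * y' - x' * y := by
    refine (cy₀.of_isCoprime_of_dvd_right hgM).symm.dvd_of_dvd_mul_left (y := y₀) ?_
    have := (g1.mul_left y').sub (g2.mul_left y)
    convert this using 1; ring
  have qR : q ∣ x * y' - x' * y := by
    refine (cy₀.of_isCoprime_of_dvd_right hqM).symm.dvd_of_dvd_mul_left (y := y₀) ?_
    have := (q1.mul_left y').sub (q2.mul_left y)
    convert this using 1; ring
  -- Both `g` and `q` divide the cross product, so only their common factor `t` separates it from
  -- divisibility by `M = g * q`. From `t ∣ 2 * x` and `t * t ∣ M` follows `t * t ∣ 4 * D * y ^ 2`,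
  -- hence `t ∣ 2`.
  set t : ℤ := (Int.gcd g q : ℤ) with ht
  have tg : t ∣ g := Int.gcd_dvd_left _ _
  have tq : t ∣ q := Int.gcd_dvd_right _ _
  have tx : t ∣ 2 * x := by
    refine (cy₀.of_isCoprime_of_dvd_right (tg.trans hgM)).symm.dvd_of_dvd_mul_left (y := y₀) ?_
    have := (tg.trans g1).add (tq.trans q1)
    convert this using 1; ring
  have tD : t * t ∣ 4 * D := by
    have cyt : IsCoprime y t := cy.of_isCoprime_of_dvd_right (tg.trans hgM)
    have cyt2 : IsCoprime (t * t) (y ^ 2) := by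
      have := cyt.symm
      exact IsCoprime.mul_left this.pow_right this.pow_right
    refine cyt2.dvd_of_dvd_mul_left (y := y ^ 2) ?_
    have e1 : t * t ∣ M := hq ▸ mul_dvd_mul tg tq
    have := (e1.mul_left 4).sub (mul_dvd_mul tx tx)
    convert this using 1
    rw [← h]; ring
  have t2 : t ∣ 2 := by
    have := dvd_two_of_mul_self_dvd_four_mul (h := Int.gcd g q) hD (by
      rw [ht] at tD
      exact_mod_cast tD)
    rw [ht]
    exact_mod_cast this
  have htR : M ∣ t * (x * y' - x' * y) := by
    have hbez := Int.gcd_eq_gcd_ab g q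
    rw [← ht] at hbez
    rw [hbez, hq, add_mul]
    refine dvd_add ?_ ?_
    · rw [mul_right_comm]
      exact (mul_dvd_mul_left g qR).mul_right _
    · rw [mul_right_comm, mul_comm g q]
      exact (mul_dvd_mul_left q gR).mul_right _
  exact htR.trans (mul_dvd_mul_right t2 _)

/-- Sort by the gcd of `M` with the cross product against a fixed `z₀`. Within a class, two
representations differ in `ℚ(√-D)` by a factor `(p + r√-D) / 2` with `p² + D r² = 4`, so `|p|, |r| ≤
2` leaves 25 choices. -/
theorem card_primitive_representations_le {D M : ℕ} (hD : Squarefree D) (hM : M ≠ 0)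
    (Z : Finset (ℤ × ℤ))
    (hZ : ∀ z ∈ Z, z.1 ^ 2 + D * z.2 ^ 2 = (M : ℤ) ∧ IsCoprime z.1 z.2) :
    #Z ≤ 25 * #M.divisors := by
  classical
  rcases Z.eq_empty_or_nonempty with h0 | ⟨z₀, hz₀⟩
  · simp [h0]
  let φ : ℤ × ℤ → ℕ := fun z => Int.gcd (z.1 * z₀.2 - z₀.1 * z.2) M
  have hD1 : (1 : ℤ) ≤ D := by exact_mod_cast Nat.pos_of_ne_zero hD.ne_zero
  have hM' : (M : ℤ) ≠ 0 := by exact_mod_cast hM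
  refine (Finset.card_le_mul_card_image_of_maps_to (f := φ) (t := M.divisors) ?_ 25 ?_)
  · intro z _
    refine Nat.mem_divisors.2 ⟨?_, hM⟩
    have := Int.gcd_dvd_right (z.1 * z₀.2 - z₀.1 * z.2) (M : ℤ)
    exact_mod_cast this
  intro g _
  rcases ({z ∈ Z | φ z = g} : Finset _).eq_empty_or_nonempty with h0 | ⟨z, hz⟩
  · rw [h0]; simp
  obtain ⟨hzZ, hzg⟩ := Finset.mem_filter.1 hz
  have hex : ∀ w ∈ ({z ∈ Z | φ z = g} : Finset _), ∃ r : ℤ × ℤ,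
      r ∈ Finset.Icc (-2 : ℤ) 2 ×ˢ Finset.Icc (-2 : ℤ) 2 ∧
        2 * w.1 = z.1 * r.1 - D * z.2 * r.2 ∧ 2 * w.2 = z.2 * r.1 + z.1 * r.2 := by
    intro w hw
    obtain ⟨hwZ, hwg⟩ := Finset.mem_filter.1 hw
    have hz1 := (hZ z hzZ).1
    have hw1 := (hZ w hwZ).1
    obtain ⟨r, hr⟩ := dvd_two_mul_cross hD (hZ z₀ hz₀).1 hz1 hw1
      (hZ z₀ hz₀).2 (hZ z hzZ).2 (hzg.trans hwg.symm)
    have e1 : (2 * (z.1 * w.1 + D * z.2 * w.2)) ^ 2 = (M : ℤ) ^ 2 * (4 - D * r ^ 2) := by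
      have : (z.1 * w.1 + D * z.2 * w.2) ^ 2 + D * (z.1 * w.2 - w.1 * z.2) ^ 2 = (M : ℤ) ^ 2 := by
        linear_combination (w.1 ^ 2 + D * w.2 ^ 2) * hz1 + (M : ℤ) * hw1
      linear_combination 4 * this - D * (2 * (z.1 * w.2 - w.1 * z.2) + M * r) * hr
    obtain ⟨p, hp⟩ := (Int.pow_dvd_pow_iff (two_ne_zero)).1 ⟨_, e1⟩
    have e2 : p ^ 2 + D * r ^ 2 = 4 := by
      refine mul_left_cancel₀ (pow_ne_zero 2 hM') ?_
      rw [hp] at e1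
      linear_combination e1
    refine ⟨(p, r), ?_, ?_, ?_⟩
    · have hp2 : p ^ 2 ≤ 2 ^ 2 := by nlinarith [sq_nonneg r]
      have hr2 : r ^ 2 ≤ 2 ^ 2 := by nlinarith [sq_nonneg p, sq_nonneg r]
      have hp3 := abs_le.1 (abs_le_of_sq_le_sq hp2 (by norm_num))
      have hr3 := abs_le.1 (abs_le_of_sq_le_sq hr2 (by norm_num))
      simp only [Finset.mem_product, Finset.mem_Icc]
      exact ⟨hp3, hr3⟩
    · refine mul_left_cancel₀ hM' ?_
      linear_combination z.1 * hp - D * z.2 * hr - 2 * w.1 * hz1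
    · refine mul_left_cancel₀ hM' ?_
      linear_combination z.2 * hp + z.1 * hr - 2 * w.2 * hz1
  choose! r hr hr1 hr2 using hex
  calc _ ≤ #(Finset.Icc (-2 : ℤ) 2 ×ˢ Finset.Icc (-2 : ℤ) 2) := by
        refine Finset.card_le_card_of_injOn r (fun w hw => hr w hw) fun w hw w' hw' he => ?_
        have a1 := hr1 w hw
        have a2 := hr2 w hw
        have b1 := hr1 w' hw'
        have b2 := hr2 w' hw'
        rw [he] at a1 a2
        exact Prod.ext (by linarith) (by linarith)
    _ = 25 := by simp

/-- The gcd `e` of the coordinates satisfies `e² ∣ M`; dividing it out gives primitive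
representations of `M / e²`. -/
theorem card_representations_le {D M : ℕ} (hD : Squarefree D) (hM : M ≠ 0)
    (Z : Finset (ℤ × ℤ)) (hZ : ∀ z ∈ Z, z.1 ^ 2 + D * z.2 ^ 2 = (M : ℤ)) :
    #Z ≤ 25 * #M.divisors * #M.divisors := by
  classical
  have hdvd : ∀ z ∈ Z, Int.gcd z.1 z.2 ^ 2 ∣ M := by
    intro z hz
    have h1 : (Int.gcd z.1 z.2 : ℤ) ^ 2 ∣ z.1 ^ 2 := pow_dvd_pow_of_dvd (Int.gcd_dvd_left _ _) 2
    have h2 : (Int.gcd z.1 z.2 : ℤ) ^ 2 ∣ z.2 ^ 2 := pow_dvd_pow_of_dvd (Int.gcd_dvd_right _ _) 2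
    have := h1.add (h2.mul_left D)
    rw [hZ z hz] at this
    exact_mod_cast this
  refine Finset.card_le_mul_card_image_of_maps_to (f := fun z : ℤ × ℤ => Int.gcd z.1 z.2)
    (t := M.divisors) ?_ (25 * #M.divisors) ?_
  · intro z hz
    exact Nat.mem_divisors.2 ⟨(dvd_pow_self _ two_ne_zero).trans (hdvd z hz), hM⟩
  intro e _
  rcases ({z ∈ Z | Int.gcd z.1 z.2 = e} : Finset _).eq_empty_or_nonempty with h0 | ⟨z, hz⟩
  · rw [h0]; simp
  obtain ⟨hzZ, hze⟩ := Finset.mem_filter.1 hz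
  obtain ⟨M', hM'⟩ : e ^ 2 ∣ M := hze ▸ hdvd z hzZ
  have he0 : e ≠ 0 := by rintro rfl; simp at hM'; exact hM hM'
  have hM'0 : M' ≠ 0 := by rintro rfl; simp at hM'; exact hM hM'
  have he0' : (e : ℤ) ≠ 0 := by exact_mod_cast he0
  have hdiv : ∀ w ∈ ({z ∈ Z | Int.gcd z.1 z.2 = e} : Finset _),
      (e : ℤ) * (w.1 / e) = w.1 ∧ (e : ℤ) * (w.2 / e) = w.2 := by
    intro w hw
    obtain ⟨hwZ, rfl⟩ := Finset.mem_filter.1 hw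
    exact ⟨Int.mul_ediv_cancel' (Int.gcd_dvd_left _ _), Int.mul_ediv_cancel' (Int.gcd_dvd_right _ _)⟩
  have hinj : Set.InjOn (fun w : ℤ × ℤ => (w.1 / (e : ℤ), w.2 / (e : ℤ)))
      ({z ∈ Z | Int.gcd z.1 z.2 = e} : Finset _) := by
    intro w hw w' hw' hww
    obtain ⟨h1, h2⟩ := hdiv w hw
    obtain ⟨h3, h4⟩ := hdiv w' hw'
    obtain ⟨h5, h6⟩ := Prod.mk.inj hww
    exact Prod.ext (by rw [← h1, ← h3, h5]) (by rw [← h2, ← h4, h6])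
  rw [← Finset.card_image_of_injOn hinj]
  calc _ ≤ 25 * #M'.divisors := by
        refine card_primitive_representations_le hD hM'0 _ fun w hw => ?_
        obtain ⟨u, hu, rfl⟩ := Finset.mem_image.1 hw
        obtain ⟨h1, h2⟩ := hdiv u hu
        obtain ⟨huZ, hue⟩ := Finset.mem_filter.1 hu
        refine ⟨?_, ?_⟩
        · refine mul_left_cancel₀ (pow_ne_zero 2 he0') ?_
          have := hZ u huZ
          rw [hM', ← h1, ← h2] at this
          push_cast at this
          linear_combination this
        · rw [Int.isCoprime_iff_gcd_eq_one, ← hue]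
          exact Int.gcd_ediv_gcd_ediv_gcd (by rw [hue]; exact Nat.pos_of_ne_zero he0)
    _ ≤ _ := Nat.mul_le_mul_left _ (Finset.card_le_card
        (Nat.divisors_subset_of_dvd hM ⟨e ^ 2, by rw [hM']; ring⟩))

/-! ### Lattice points on circles -/

/-- Gram determinant of a pair of integer vectors. -/
def gram {d : ℕ} (u₁ u₂ : Fin d → ℤ) : ℤ :=
  (u₁ ⬝ᵥ u₁) * (u₂ ⬝ᵥ u₂) - (u₁ ⬝ᵥ u₂) ^ 2

/-- Strict Cauchy–Schwarz: both vectors lie on the sphere through `0` about `c`, and a line through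
`0` meets it in at most one other point. -/
theorem gram_pos {d : ℕ} {c u₁ u₂ : Fin d → ℤ} (h₁ : u₁ ⬝ᵥ u₁ = 2 * (c ⬝ᵥ u₁))
    (h₂ : u₂ ⬝ᵥ u₂ = 2 * (c ⬝ᵥ u₂)) (h0 : u₁ ≠ 0) (h0' : u₂ ≠ 0) (hne : u₁ ≠ u₂) :
    0 < gram u₁ u₂ := by
  set a := u₁ ⬝ᵥ u₁ with ha
  set b := u₁ ⬝ᵥ u₂ with hb
  set e := u₂ ⬝ᵥ u₂ with he
  have ha0 : 0 < a := lt_of_le_of_ne (Finset.sum_nonneg fun i _ => mul_self_nonneg _)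
    (Ne.symm (mt dotProduct_self_eq_zero.1 h0))
  have he0 : 0 < e := lt_of_le_of_ne (Finset.sum_nonneg fun i _ => mul_self_nonneg _)
    (Ne.symm (mt dotProduct_self_eq_zero.1 h0'))
  have hb' : u₂ ⬝ᵥ u₁ = b := dotProduct_comm _ _
  have hw : (a • u₂ - b • u₁) ⬝ᵥ (a • u₂ - b • u₁) = a * gram u₁ u₂ := by
    simp only [dotProduct_sub, sub_dotProduct, smul_dotProduct, dotProduct_smul, smul_eq_mul,
      ← ha, ← hb, ← he, hb', gram]
    ring
  have hnn : 0 ≤ a * gram u₁ u₂ := hw ▸ Finset.sum_nonneg fun i _ => mul_self_nonneg _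
  refine lt_of_le_of_ne (nonneg_of_mul_nonneg_right hnn ha0) fun hG => ?_
  rw [← hG, mul_zero] at hw
  have hw0 : a • u₂ = b • u₁ := sub_eq_zero.1 (dotProduct_self_eq_zero.1 hw)
  have hc : a * e = b * a := by
    have := congrArg (fun w => 2 * (c ⬝ᵥ w)) hw0
    simp only [dotProduct_smul, smul_eq_mul] at this
    linear_combination this + a * h₂ - b * h₁
  have heb : e = b := mul_left_cancel₀ ha0.ne' (by rw [hc]; ring)
  have hab : a = b := by
    have hG' : a * e - b ^ 2 = 0 := hG.symm
    refine mul_right_cancel₀ he0.ne' ?_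
    rw [heb] at hG' ⊢
    linear_combination hG'
  rw [hab] at hw0
  have hb0 : b ≠ 0 := hab ▸ ha0.ne'
  exact hne (smul_right_injective _ hb0 hw0).symm

theorem dotProduct_self_le_of_eq {d : ℕ} {c u : Fin d → ℤ} (h : u ⬝ᵥ u = 2 * (c ⬝ᵥ u)) :
    u ⬝ᵥ u ≤ 4 * (c ⬝ᵥ c) := by
  have hnn : 0 ≤ (u - 2 • c) ⬝ᵥ (u - 2 • c) := Finset.sum_nonneg fun i _ => mul_self_nonneg _
  simp only [dotProduct_sub, sub_dotProduct, smul_dotProduct, dotProduct_smul,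
    dotProduct_comm u c] at hnn
  simp only [nsmul_eq_mul, Nat.cast_ofNat] at hnn
  linarith

/-- The lattice points of a circle are controlled by the representations of a number `M` by
a principal binary form. -/
theorem exists_card_circle_le_divisors {d : ℕ} {c u₁ u₂ : Fin d → ℤ}
    (h₁ : u₁ ⬝ᵥ u₁ = 2 * (c ⬝ᵥ u₁)) (h₂ : u₂ ⬝ᵥ u₂ = 2 * (c ⬝ᵥ u₂)) (h0 : u₁ ≠ 0) (h0' : u₂ ≠ 0)
    (hne : u₁ ≠ u₂) (Z : Finset (Fin d → ℤ)) (hZ : ∀ z ∈ Z, z ⬝ᵥ z = 2 * (c ⬝ᵥ z))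
    (hspan : ∀ z ∈ Z, ∃ A B : ℤ, gram u₁ u₂ • z = A • u₁ + B • u₂) :
    ∃ M : ℕ, M ≠ 0 ∧ (M : ℤ) ≤ 20480 * (c ⬝ᵥ c) ^ 6 ∧ #Z ≤ 25 * #M.divisors * #M.divisors := by
  classical
  have hG := gram_pos h₁ h₂ h0 h0' hne
  set G := gram u₁ u₂ with hGdef
  set a := u₁ ⬝ᵥ u₁ with ha
  set b := u₁ ⬝ᵥ u₂ with hb
  set e := u₂ ⬝ᵥ u₂ with he
  have hGe : G = a * e - b ^ 2 := rfl
  have ha0 : 0 < a := lt_of_le_of_ne (Finset.sum_nonneg fun i _ => mul_self_nonneg _)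
    (Ne.symm (mt dotProduct_self_eq_zero.1 h0))
  have he0 : 0 < e := lt_of_le_of_ne (Finset.sum_nonneg fun i _ => mul_self_nonneg _)
    (Ne.symm (mt dotProduct_self_eq_zero.1 h0'))
  have hb' : u₂ ⬝ᵥ u₁ = b := dotProduct_comm _ _
  set l := c ⬝ᵥ c with hl
  have hal : a ≤ 4 * l := dotProduct_self_le_of_eq h₁
  have hel : e ≤ 4 * l := dotProduct_self_le_of_eq h₂
  have hbl : |b| ≤ 4 * l := by
    have hp : 0 ≤ (u₁ + u₂) ⬝ᵥ (u₁ + u₂) := Finset.sum_nonneg fun i _ => mul_self_nonneg _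
    have hm : 0 ≤ (u₁ - u₂) ⬝ᵥ (u₁ - u₂) := Finset.sum_nonneg fun i _ => mul_self_nonneg _
    simp only [dotProduct_add, add_dotProduct, dotProduct_sub, sub_dotProduct, ← ha, ← hb, ← he,
      hb'] at hp hm
    rw [abs_le]
    constructor <;> linarith
  -- The constant left after completing the square in the conic satisfied by `(A, B)`.
  set M : ℤ := G ^ 2 * a ^ 2 + G * (a ^ 2 * (e - b) ^ 2) with hM
  have hMpos : 0 < M := by positivity
  have hMle : M ≤ 20480 * l ^ 6 := by
    have hl0 : 0 ≤ l := by linarith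
    have hGl : G ≤ 16 * l ^ 2 := by nlinarith [sq_nonneg b]
    have hebl : (e - b) ^ 2 ≤ (8 * l) ^ 2 := by
      have := abs_le.1 hbl
      exact sq_le_sq' (by linarith) (by linarith)
    calc M ≤ (16 * l ^ 2) ^ 2 * (4 * l) ^ 2 + (16 * l ^ 2) * ((4 * l) ^ 2 * (8 * l) ^ 2) := by
          rw [hM]; gcongr
      _ = _ := by ring
  -- The square part of `G` is absorbed into the second variable, leaving a squarefree `D`.
  obtain ⟨D, q, hqD, hD⟩ := Nat.sq_mul_squarefree G.toNat
  have hGnat : (G.toNat : ℤ) = G := Int.toNat_of_nonneg hG.le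
  have hGq : G = q ^ 2 * D := by rw [← hGnat, ← hqD]; push_cast; ring
  have hq0 : (q : ℤ) ≠ 0 := by
    intro h
    rw [h] at hGq
    simp at hGq
    omega
  choose! A B hAB using hspan
  have hquad : ∀ z ∈ Z, (2 * a * A z + 2 * b * B z - G * a) ^ 2 +
      D * (q * (2 * B z - a * (e - b))) ^ 2 = M := by
    intro z hz
    have hzz := hZ z hz
    have hz1 : G ^ 2 * (z ⬝ᵥ z) = a * A z ^ 2 + 2 * b * (A z * B z) + e * B z ^ 2 := by
      have := congrArg (fun w => w ⬝ᵥ w) (hAB z hz)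
      simp only [dotProduct_add, add_dotProduct, smul_dotProduct, dotProduct_smul, smul_eq_mul,
        ← ha, ← hb, ← he, hb'] at this
      linear_combination this
    have hz2 : G * (2 * (c ⬝ᵥ z)) = A z * a + B z * e := by
      have := congrArg (fun w => 2 * (c ⬝ᵥ w)) (hAB z hz)
      simp only [dotProduct_add, dotProduct_smul, smul_eq_mul] at this
      rw [h₁, h₂]
      linear_combination this
    have hz3 : a * A z ^ 2 + 2 * b * (A z * B z) + e * B z ^ 2 = G * (A z * a + B z * e) := by
      rw [← hz1, ← hz2, hzz]; ring
    have hD' : (D : ℤ) * (q * (2 * B z - a * (e - b))) ^ 2 =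
        G * (2 * B z - a * (e - b)) ^ 2 := by rw [hGq]; ring
    rw [hD', hM]
    linear_combination 4 * a * hz3 + 4 * (B z) ^ 2 * hGe
  have hinj : Set.InjOn (fun z => (2 * a * A z + 2 * b * B z - G * a,
      (q : ℤ) * (2 * B z - a * (e - b)))) Z := by
    intro z hz w hw hzw
    obtain ⟨e1, e2⟩ := Prod.mk.inj hzw
    have e3 := mul_left_cancel₀ hq0 e2
    have hBB : B z = B w := by linarith
    have hAA : A z = A w := by
      rw [hBB] at e1
      refine mul_left_cancel₀ (mul_ne_zero two_ne_zero ha0.ne') ?_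
      linarith
    refine smul_right_injective _ hG.ne' ?_
    change G • z = G • w
    rw [hAB z hz, hAB w hw, hAA, hBB]
  have hMnat : (M.toNat : ℤ) = M := Int.toNat_of_nonneg hMpos.le
  refine ⟨M.toNat, by omega, by rw [hMnat]; exact hMle, ?_⟩
  rw [← Finset.card_image_of_injOn hinj]
  refine card_representations_le hD (by omega) _ fun w hw => ?_
  obtain ⟨z, hz, rfl⟩ := Finset.mem_image.1 hw
  rw [hMnat]
  exact hquad z hz

/-- **Lattice points on circles.** -/
theorem exists_card_circle_le (η : ℝ) (hη : 0 < η) : ∃ C : ℝ, 1 ≤ C ∧ ∀ (lam d : ℕ)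
    (c u₁ u₂ : Fin d → ℤ), 1 ≤ lam → c ⬝ᵥ c = lam → u₁ ⬝ᵥ u₁ = 2 * (c ⬝ᵥ u₁) →
    u₂ ⬝ᵥ u₂ = 2 * (c ⬝ᵥ u₂) → u₁ ≠ 0 → u₂ ≠ 0 → u₁ ≠ u₂ → ∀ Z : Finset (Fin d → ℤ),
    (∀ z ∈ Z, z ⬝ᵥ z = 2 * (c ⬝ᵥ z)) →
    (∀ z ∈ Z, ∃ A B : ℤ, gram u₁ u₂ • z = A • u₁ + B • u₂) →
    (#Z : ℝ) ≤ C * (scaleN lam : ℝ) ^ η := by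
  -- Two divisor factors and `M = O(N¹²)` turn exponent `η / 24` into `N ^ η`.
  obtain ⟨C, hC1, hC⟩ := exists_card_divisors_le_rpow (η / 24) (by positivity)
  have h20 : (1 : ℝ) ≤ (20480 : ℝ) ^ (η / 12) := Real.one_le_rpow (by norm_num) (by positivity)
  refine ⟨25 * C ^ 2 * 20480 ^ (η / 12), ?_, ?_⟩
  · have : 1 ≤ C ^ 2 := one_le_pow₀ hC1
    nlinarith
  intro lam d c u₁ u₂ hlam hc h₁ h₂ h0 h0' hne Z hZ hspan
  obtain ⟨M, hM0, hMle, hcard⟩ := exists_card_circle_le_divisors h₁ h₂ h0 h0' hne Z hZ hspan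
  have hN : (lam : ℝ) ≤ (scaleN lam : ℝ) ^ 2 := by
    have := Nat.lt_succ_sqrt lam
    have h2 : lam ≤ (scaleN lam) ^ 2 := by
      rw [scaleN, sq]; exact this.le
    exact_mod_cast h2
  have hMN : (M : ℝ) ≤ 20480 * (scaleN lam : ℝ) ^ 12 := by
    rw [hc] at hMle
    calc (M : ℝ) ≤ 20480 * (lam : ℝ) ^ 6 := by exact_mod_cast hMle
      _ ≤ 20480 * ((scaleN lam : ℝ) ^ 2) ^ 6 := by gcongr
      _ = _ := by ring
  have hpow : ((M : ℝ) ^ (η / 24)) ^ 2 ≤ 20480 ^ (η / 12) * (scaleN lam : ℝ) ^ η := by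
    calc ((M : ℝ) ^ (η / 24)) ^ 2 = (M : ℝ) ^ (η / 12) := by
          rw [← Real.rpow_natCast, ← Real.rpow_mul (by positivity)]
          congr 1; push_cast; ring
      _ ≤ (20480 * (scaleN lam : ℝ) ^ 12) ^ (η / 12) := by gcongr
      _ = _ := by
          rw [Real.mul_rpow (by norm_num) (by positivity), ← Real.rpow_natCast _ 12,
            ← Real.rpow_mul (by positivity)]
          congr 2; push_cast; ring
  calc (#Z : ℝ) ≤ 25 * #M.divisors * #M.divisors := by exact_mod_cast hcard
    _ ≤ 25 * (C * (M : ℝ) ^ (η / 24)) * (C * (M : ℝ) ^ (η / 24)) := by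
        gcongr <;> exact hC M hM0
    _ = 25 * C ^ 2 * ((M : ℝ) ^ (η / 24)) ^ 2 := by ring
    _ ≤ 25 * C ^ 2 * (20480 ^ (η / 12) * (scaleN lam : ℝ) ^ η) := by gcongr
    _ = _ := by ring

/-! ### Few common neighbours in dimension five -/

/-- An integer vector seen as a real one. -/
def realVec {d : ℕ} (v : Fin d → ℤ) : Fin d → ℝ := fun i => v i

theorem realVec_dotProduct {d : ℕ} (u v : Fin d → ℤ) :
    realVec u ⬝ᵥ realVec v = ((u ⬝ᵥ v : ℤ) : ℝ) := by
  simp [dotProduct, realVec]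

/-- Cramer's rule: the Gram determinant clears the denominators of the coefficients. -/
theorem gram_smul_eq_of_mem_span {d : ℕ} {u₁ u₂ z : Fin d → ℤ}
    (hz : realVec z ∈ Submodule.span ℝ {realVec u₁, realVec u₂}) :
    ∃ A B : ℤ, gram u₁ u₂ • z = A • u₁ + B • u₂ := by
  obtain ⟨s, t, hst⟩ := Submodule.mem_span_pair.1 hz
  have hb : u₂ ⬝ᵥ u₁ = u₁ ⬝ᵥ u₂ := dotProduct_comm _ _
  have e1 : ((u₁ ⬝ᵥ z : ℤ) : ℝ) = s * (u₁ ⬝ᵥ u₁ : ℤ) + t * (u₁ ⬝ᵥ u₂ : ℤ) := by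
    rw [← realVec_dotProduct, ← hst, dotProduct_add, dotProduct_smul, dotProduct_smul,
      realVec_dotProduct, realVec_dotProduct, smul_eq_mul, smul_eq_mul]
  have e2 : ((u₂ ⬝ᵥ z : ℤ) : ℝ) = s * (u₁ ⬝ᵥ u₂ : ℤ) + t * (u₂ ⬝ᵥ u₂ : ℤ) := by
    rw [← realVec_dotProduct, ← hst, dotProduct_add, dotProduct_smul, dotProduct_smul,
      realVec_dotProduct, realVec_dotProduct, smul_eq_mul, smul_eq_mul, hb]
  refine ⟨(u₂ ⬝ᵥ u₂) * (u₁ ⬝ᵥ z) - (u₁ ⬝ᵥ u₂) * (u₂ ⬝ᵥ z),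
    (u₁ ⬝ᵥ u₁) * (u₂ ⬝ᵥ z) - (u₁ ⬝ᵥ u₂) * (u₁ ⬝ᵥ z), ?_⟩
  ext i
  have hi : (z i : ℝ) = s * u₁ i + t * u₂ i := by
    have := congrFun hst i
    simpa [realVec] using this.symm
  simp only [Pi.smul_apply, Pi.add_apply, smul_eq_mul, gram]
  have : (((u₁ ⬝ᵥ u₁) * (u₂ ⬝ᵥ u₂) - (u₁ ⬝ᵥ u₂) ^ 2 : ℤ) : ℝ) * z i =
      (((u₂ ⬝ᵥ u₂) * (u₁ ⬝ᵥ z) - (u₁ ⬝ᵥ u₂) * (u₂ ⬝ᵥ z) : ℤ) : ℝ) * u₁ i +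
      (((u₁ ⬝ᵥ u₁) * (u₂ ⬝ᵥ z) - (u₁ ⬝ᵥ u₂) * (u₁ ⬝ᵥ z) : ℤ) : ℝ) * u₂ i := by
    push_cast
    rw [e1, e2, hi]
    ring
  exact_mod_cast this

theorem linearIndependent_pair_of_gram_ne_zero {d : ℕ} {u₁ u₂ : Fin d → ℤ}
    (hG : gram u₁ u₂ ≠ 0) : LinearIndependent ℝ ![realVec u₁, realVec u₂] := by
  rw [LinearIndependent.pair_iff]
  intro s t hst
  have hb : u₂ ⬝ᵥ u₁ = u₁ ⬝ᵥ u₂ := dotProduct_comm _ _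
  have e1 : s * (u₁ ⬝ᵥ u₁ : ℤ) + t * ((u₁ ⬝ᵥ u₂ : ℤ) : ℝ) = 0 := by
    have := congrArg (realVec u₁ ⬝ᵥ ·) hst
    simpa only [dotProduct_add, dotProduct_smul, realVec_dotProduct, smul_eq_mul,
      dotProduct_zero] using this
  have e2 : s * (u₁ ⬝ᵥ u₂ : ℤ) + t * ((u₂ ⬝ᵥ u₂ : ℤ) : ℝ) = 0 := by
    have := congrArg (realVec u₂ ⬝ᵥ ·) hst
    simpa only [dotProduct_add, dotProduct_smul, realVec_dotProduct, smul_eq_mul,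
      dotProduct_zero, hb] using this
  have hG' : (((u₁ ⬝ᵥ u₁ : ℤ) : ℝ) * (u₂ ⬝ᵥ u₂ : ℤ) - ((u₁ ⬝ᵥ u₂ : ℤ) : ℝ) ^ 2) ≠ 0 := by
    exact_mod_cast hG
  constructor
  · refine (mul_eq_zero.1 (?_ : _ * s = 0)).resolve_left hG'
    linear_combination ((u₂ ⬝ᵥ u₂ : ℤ) : ℝ) * e1 - ((u₁ ⬝ᵥ u₂ : ℤ) : ℝ) * e2
  · refine (mul_eq_zero.1 (?_ : _ * t = 0)).resolve_left hG'
    linear_combination ((u₁ ⬝ᵥ u₁ : ℤ) : ℝ) * e2 - ((u₁ ⬝ᵥ u₂ : ℤ) : ℝ) * e1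

/-- The common orthogonal complement of three independent vectors of `ℝ⁵` is spanned by any two
of its independent vectors. -/
theorem mem_span_pair_of_orthogonal {V : Fin 3 → Fin 5 → ℝ} (hV : LinearIndependent ℝ V)
    {u₁ u₂ z : Fin 5 → ℝ} (hu : LinearIndependent ℝ ![u₁, u₂]) (h₁ : ∀ i, V i ⬝ᵥ u₁ = 0)
    (h₂ : ∀ i, V i ⬝ᵥ u₂ = 0) (hz : ∀ i, V i ⬝ᵥ z = 0) : z ∈ Submodule.span ℝ {u₁, u₂} := by
  let T := (Matrix.of V).mulVecLin
  have hmem : ∀ w, (∀ i, V i ⬝ᵥ w = 0) → w ∈ LinearMap.ker T := by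
    intro w hw
    rw [LinearMap.mem_ker]
    ext i
    exact hw i
  have hrank : Module.finrank ℝ (LinearMap.range T) = 3 := by
    have h := LinearIndependent.rank_matrix (M := Matrix.of V) hV
    simpa [Matrix.rank] using h
  have hker : Module.finrank ℝ (LinearMap.ker T) = 2 := by
    have := LinearMap.finrank_range_add_finrank_ker T
    rw [hrank, Module.finrank_fin_fun] at this
    omega
  have hle : Submodule.span ℝ {u₁, u₂} ≤ LinearMap.ker T := by
    rw [Submodule.span_le]
    rintro w (rfl | rfl)
    · exact hmem _ h₁
    · exact hmem _ h₂
  have hspan : Module.finrank ℝ (Submodule.span ℝ ({u₁, u₂} : Set (Fin 5 → ℝ))) = 2 := by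
    have := finrank_span_eq_card hu
    rwa [Matrix.range_cons_cons_empty, Fintype.card_fin] at this
  rw [Submodule.eq_of_le_of_finrank_eq hle (hspan.trans hker.symm)]
  exact hmem z hz

theorem dotProduct_eq_of_mem_latticeSphere {n lam : ℕ} {a : Fin n → ℤ}
    (ha : a ∈ latticeSphere n lam) : a ⬝ᵥ a = lam := by
  have h : ∑ i, |a i| ^ 2 = (lam : ℤ) := ha
  rw [← h]
  simp [dotProduct, sq]

/-- Three independent hyperplanes cut the sphere in few lattice points; the lattice points of a
sphere through the origin in the span of two vectors are few. -/
theorem exists_card_common_neighbours_le (η : ℝ) (hη : 0 < η) : ∃ C : ℝ, 2 ≤ C ∧ ∀ lam : ℕ,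
    1 ≤ lam →
    (∀ Λ : Finset (Fin 5 → ℤ), (Λ : Set (Fin 5 → ℤ)) ⊆ latticeSphere 5 lam →
      ∀ v : Fin 3 → Fin 5 → ℤ, LinearIndependent ℝ (fun i => realVec (v i)) →
      (∀ a ∈ Λ, ∀ i, 2 * (a ⬝ᵥ v i) = v i ⬝ᵥ v i) → (#Λ : ℝ) ≤ C * (scaleN lam : ℝ) ^ η) ∧
    ∀ a ∈ latticeSphere 5 lam, ∀ v₁ v₂ : Fin 5 → ℤ, v₁ ≠ 0 → v₂ ≠ 0 → v₁ ≠ v₂ →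
      2 * (a ⬝ᵥ v₁) = v₁ ⬝ᵥ v₁ → 2 * (a ⬝ᵥ v₂) = v₂ ⬝ᵥ v₂ → ∀ V : Finset (Fin 5 → ℤ),
      (∀ v ∈ V, 2 * (a ⬝ᵥ v) = v ⬝ᵥ v ∧
        ¬ LinearIndependent ℝ ![realVec v, realVec v₁, realVec v₂]) →
      (#V : ℝ) ≤ C * (scaleN lam : ℝ) ^ η := by
  classical
  obtain ⟨C, hC1, hC⟩ := exists_card_circle_le η hη
  -- The factor 2 covers sets of at most two points, which do not determine a circle.
  refine ⟨2 * C, by linarith, fun lam hlam => ⟨?_, ?_⟩⟩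
  · intro Λ hΛ v hv hinc
    have hN : (1 : ℝ) ≤ (scaleN lam : ℝ) ^ η := by
      refine Real.one_le_rpow ?_ hη.le
      simp [scaleN]
    by_cases h2 : #Λ ≤ 2
    · have : (#Λ : ℝ) ≤ 2 := by exact_mod_cast h2
      nlinarith
    · push Not at h2
      obtain ⟨a₀, a₁, a₂, ha₀, ha₁, ha₂, h01, h02, h12⟩ := Finset.two_lt_card_iff.1 h2
      have hsph : ∀ a ∈ Λ, a ⬝ᵥ a = lam := fun a ha => dotProduct_eq_of_mem_latticeSphere (hΛ ha)
      -- Translation by `-a₀` moves the sphere to one through `0` with centre `-a₀`.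
      have hcirc : ∀ a ∈ Λ, (a - a₀) ⬝ᵥ (a - a₀) = 2 * ((-a₀) ⬝ᵥ (a - a₀)) := by
        intro a ha
        simp only [dotProduct_sub, sub_dotProduct, neg_dotProduct, dotProduct_comm a a₀,
          hsph a ha, hsph a₀ ha₀]
        ring
      have horth : ∀ a ∈ Λ, ∀ i, realVec (v i) ⬝ᵥ realVec (a - a₀) = 0 := by
        intro a ha i
        rw [realVec_dotProduct, dotProduct_sub, dotProduct_comm, dotProduct_comm (v i) a₀]
        have e1 := hinc a ha i
        have e2 := hinc a₀ ha₀ i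
        have : a ⬝ᵥ v i - a₀ ⬝ᵥ v i = 0 := by linarith
        rw [this]; simp
      have hn1 : a₁ - a₀ ≠ 0 := sub_ne_zero.2 h01.symm
      have hn2 : a₂ - a₀ ≠ 0 := sub_ne_zero.2 h02.symm
      have hn12 : a₁ - a₀ ≠ a₂ - a₀ := fun h => h12 (sub_left_injective h)
      have hli := linearIndependent_pair_of_gram_ne_zero
        (gram_pos (hcirc a₁ ha₁) (hcirc a₂ ha₂) hn1 hn2 hn12).ne'
      have key := hC lam 5 (-a₀) (a₁ - a₀) (a₂ - a₀) hlam (by simp [hsph a₀ ha₀])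
        (hcirc a₁ ha₁) (hcirc a₂ ha₂) hn1 hn2 hn12 (Λ.image (· - a₀)) (by
          intro z hz
          obtain ⟨a, ha, rfl⟩ := Finset.mem_image.1 hz
          exact hcirc a ha) (by
          intro z hz
          obtain ⟨a, ha, rfl⟩ := Finset.mem_image.1 hz
          exact gram_smul_eq_of_mem_span (mem_span_pair_of_orthogonal hv hli (horth a₁ ha₁)
            (horth a₂ ha₂) (horth a ha)))
      rw [Finset.card_image_of_injective _ sub_left_injective] at key
      nlinarith
  · intro a ha v₁ v₂ h0 h0' hne h₁ h₂ V hV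
    have hli := linearIndependent_pair_of_gram_ne_zero
      (gram_pos h₁.symm h₂.symm h0 h0' hne).ne'
    have key := hC lam 5 a v₁ v₂ hlam (dotProduct_eq_of_mem_latticeSphere ha) h₁.symm h₂.symm
      h0 h0' hne V (fun z hz => (hV z hz).1.symm) (fun z hz => gram_smul_eq_of_mem_span (by
        have h := (hV z hz).2
        rw [Matrix.vecCons, linearIndependent_finCons, not_and, not_not] at h
        rw [← Matrix.range_cons_cons_empty (realVec v₁) (realVec v₂) ![]]
        exact h hli))
    have : 0 ≤ C * (scaleN lam : ℝ) ^ η := by positivity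
    linarith

/-! ### From rich sums to additive energy -/

open scoped Pointwise

/-- Number of representations of `v` as a sum of two elements of `Λ`. -/
def sumReps (Λ : Finset (Fin 5 → ℤ)) (v : Fin 5 → ℤ) : ℕ :=
  #{xy ∈ Λ ×ˢ Λ | xy.1 + xy.2 = v}

/-- If `x + y = v` with `|x| = |y|`, then `2 x·v = 2|x|² + 2 x·y = |v|²`, and `x` determines `y`. -/
theorem sumReps_le_card_incident {lam : ℕ} {Λ : Finset (Fin 5 → ℤ)}
    (hΛ : (Λ : Set (Fin 5 → ℤ)) ⊆ latticeSphere 5 lam) (v : Fin 5 → ℤ) :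
    sumReps Λ v ≤ #{a : Λ | 2 * ((a : Fin 5 → ℤ) ⬝ᵥ v) = v ⬝ᵥ v} := by
  classical
  have himg : #(({a : Λ | 2 * ((a : Fin 5 → ℤ) ⬝ᵥ v) = v ⬝ᵥ v} : Finset Λ).image
      (Subtype.val)) = #{a : Λ | 2 * ((a : Fin 5 → ℤ) ⬝ᵥ v) = v ⬝ᵥ v} :=
    Finset.card_image_of_injective _ Subtype.val_injective
  rw [← himg]
  refine Finset.card_le_card_of_injOn Prod.fst ?_ ?_
  · rintro ⟨x, y⟩ hxy
    simp only [Finset.coe_filter, Finset.mem_product, Set.mem_ofPred_eq] at hxy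
    obtain ⟨⟨hx, hy⟩, rfl⟩ := hxy
    have ex := dotProduct_eq_of_mem_latticeSphere (hΛ hx)
    have ey := dotProduct_eq_of_mem_latticeSphere (hΛ hy)
    simp only [Finset.coe_image, Set.mem_image, Finset.mem_coe, Finset.mem_filter,
      Finset.mem_univ, true_and]
    refine ⟨⟨x, hx⟩, ?_, rfl⟩
    simp only [dotProduct_add, add_dotProduct, dotProduct_comm y x, ex, ey]
    ring
  · rintro ⟨x, y⟩ hxy ⟨x', y'⟩ hxy' h
    simp only [Finset.coe_filter, Set.mem_ofPred_eq] at hxy hxy'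
    obtain rfl : x = x' := h
    have : x + y = x + y' := hxy.2.trans hxy'.2.symm
    rw [add_left_cancel this]

theorem sumReps_le_card {lam : ℕ} {Λ : Finset (Fin 5 → ℤ)}
    (hΛ : (Λ : Set (Fin 5 → ℤ)) ⊆ latticeSphere 5 lam) (v : Fin 5 → ℤ) :
    sumReps Λ v ≤ #Λ :=
  (sumReps_le_card_incident hΛ v).trans ((Finset.card_le_univ _).trans (by simp))

theorem sum_sumReps (Λ : Finset (Fin 5 → ℤ)) : ∑ v ∈ Λ + Λ, sumReps Λ v = #Λ ^ 2 := by
  rw [sq, ← Finset.card_product]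
  exact (Finset.card_eq_sum_card_fiberwise (f := fun xy : (Fin 5 → ℤ) × (Fin 5 → ℤ) => xy.1 + xy.2)
    fun xy hxy => Finset.add_mem_add (Finset.mem_product.1 hxy).1 (Finset.mem_product.1 hxy).2).symm

/-- The functional `(y, z) ↦ 2 a · y - z`, which vanishes at `(v, |v|²)` iff `a` and `v - a` have
equal length. -/
def incidenceFunctional (a : Fin 5 → ℤ) : Module.Dual ℝ ((Fin 5 → ℝ) × ℝ) :=
  (2 • ∑ i, (a i : ℝ) • LinearMap.proj i) ∘ₗ LinearMap.fst ℝ (Fin 5 → ℝ) ℝ -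
    LinearMap.snd ℝ (Fin 5 → ℝ) ℝ

theorem incidenceFunctional_eq_zero_iff (a v : Fin 5 → ℤ) :
    incidenceFunctional a (realVec v, ((v ⬝ᵥ v : ℤ) : ℝ)) = 0 ↔ 2 * (a ⬝ᵥ v) = v ⬝ᵥ v := by
  have h : incidenceFunctional a (realVec v, ((v ⬝ᵥ v : ℤ) : ℝ)) =
      ((2 * (a ⬝ᵥ v) - v ⬝ᵥ v : ℤ) : ℝ) := by
    simp [incidenceFunctional, realVec, dotProduct, Finset.mul_sum, two_mul,
      Finset.sum_add_distrib]
  rw [h, Int.cast_eq_zero, sub_eq_zero]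

/-- The nonzero vectors with at least `k` representations. -/
def richSums (Λ : Finset (Fin 5 → ℤ)) (k : ℕ) : Finset (Fin 5 → ℤ) :=
  {v ∈ Λ + Λ | v ≠ 0 ∧ k ≤ sumReps Λ v}

theorem card_mul_sq_le_sqrt_pow (n : ℕ) : (n : ℝ) ^ 2 ≤ √n ^ 5 := by
  rcases Nat.eq_zero_or_pos n with rfl | hn
  · simp
  · have h1 : (1 : ℝ) ≤ √n := Real.one_le_sqrt.2 (by exact_mod_cast hn)
    calc (n : ℝ) ^ 2 = √n ^ 4 := by
          rw [show √(n : ℝ) ^ 4 = (√n ^ 2) ^ 2 by ring, Real.sq_sqrt (Nat.cast_nonneg n)]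
      _ ≤ √n ^ 5 := pow_le_pow_right₀ h1 (by norm_num)

/-- For `k ≥ max (4 * B) √n` this is the rich point bound for the lifts. Otherwise `∑ r(v) = n²`
bounds `m * k`, and the remaining factor `k` is at most `4 * B + √n`. -/
theorem card_richSums_mul_sq_le {lam : ℕ} (Λ : Finset (Fin 5 → ℤ))
    (hΛ : (Λ : Set (Fin 5 → ℤ)) ⊆ latticeSphere 5 lam) (B : ℝ) (hB : 1 ≤ B)
    (h1 : ∀ P ⊆ Λ, ∀ v : Fin 3 → Fin 5 → ℤ, LinearIndependent ℝ (fun i => realVec (v i)) →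
      (∀ a ∈ P, ∀ i, 2 * (a ⬝ᵥ v i) = v i ⬝ᵥ v i) → (#P : ℝ) ≤ B)
    (h2 : ∀ a ∈ Λ, ∀ v₁ v₂ : Fin 5 → ℤ, v₁ ≠ 0 → v₂ ≠ 0 → v₁ ≠ v₂ →
      2 * (a ⬝ᵥ v₁) = v₁ ⬝ᵥ v₁ → 2 * (a ⬝ᵥ v₂) = v₂ ⬝ᵥ v₂ → ∀ V : Finset (Fin 5 → ℤ),
      (∀ v ∈ V, 2 * (a ⬝ᵥ v) = v ⬝ᵥ v ∧
        ¬ LinearIndependent ℝ ![realVec v, realVec v₁, realVec v₂]) → (#V : ℝ) ≤ B)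
    (hlog : 73 * Real.log (#Λ + 1) ≤ B) (k : ℕ) :
    (#(richSums Λ k) : ℝ) * k ^ 2 ≤ 57 * 21 ^ 5 * 65 ^ 5 * B ^ 11 * √(#Λ) ^ 5 := by
  classical
  by_cases hk : 4 * B ≤ k ∧ √(#Λ) ≤ k
  · have key := card_rich_mul_sq_le (E := (Fin 5 → ℝ) × ℝ) (α := Λ) (ι := richSums Λ k)
      (by simp) (fun a => incidenceFunctional a)
      (fun v => (realVec (v : Fin 5 → ℤ), (((v : Fin 5 → ℤ) ⬝ᵥ (v : Fin 5 → ℤ) : ℤ) : ℝ)))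
      (fun a v => 2 * ((a : Fin 5 → ℤ) ⬝ᵥ (v : Fin 5 → ℤ)) = (v : Fin 5 → ℤ) ⬝ᵥ (v : Fin 5 → ℤ))
      (fun a v => (incidenceFunctional_eq_zero_iff a v).symm)
      (fun v₁ v₂ v₃ => LinearIndependent ℝ
        ![realVec (v₃ : Fin 5 → ℤ), realVec (v₁ : Fin 5 → ℤ), realVec (v₂ : Fin 5 → ℤ)])
      B hB ?_ ?_ (by simpa using hlog) k hk.1 (by simpa using hk.2) ?_
    · simpa using key
    · intro v₁ v₂ v₃ hI
      rw [← Finset.card_image_of_injective _ Subtype.val_injective]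
      refine h1 _ ?_ ![v₃, v₁, v₂] ?_ ?_
      · intro a ha
        obtain ⟨b, -, rfl⟩ := Finset.mem_image.1 ha
        exact b.2
      · convert hI using 1
        ext i : 1
        fin_cases i <;> rfl
      · intro a ha
        obtain ⟨b, hb, rfl⟩ := Finset.mem_image.1 ha
        obtain ⟨e1, e2, e3⟩ := (Finset.mem_filter.1 hb).2
        intro i
        fin_cases i
        · exact e3
        · exact e1
        · exact e2
    · intro a v₁ v₂ hne e1 e2
      have hv0 : ∀ v : richSums Λ k, (v : Fin 5 → ℤ) ≠ 0 := fun v =>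
        (Finset.mem_filter.1 v.2).2.1
      rw [← Finset.card_image_of_injective _ Subtype.val_injective]
      refine h2 a a.2 v₁ v₂ (hv0 v₁) (hv0 v₂) (fun h => hne (Subtype.ext h)) e1 e2 _ ?_
      intro v hv
      obtain ⟨w, hw, rfl⟩ := Finset.mem_image.1 hv
      exact (Finset.mem_filter.1 hw).2
    · intro v
      have e1 := (Finset.mem_filter.1 v.2).2.2
      exact_mod_cast e1.trans (sumReps_le_card_incident hΛ v)
  · have hsum : #(richSums Λ k) * k ≤ #Λ ^ 2 := by
      rw [← sum_sumReps, ← smul_eq_mul, ← Finset.sum_const]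
      calc _ ≤ ∑ v ∈ richSums Λ k, sumReps Λ v :=
            Finset.sum_le_sum fun v hv => (Finset.mem_filter.1 hv).2.2
        _ ≤ _ := Finset.sum_le_sum_of_subset (Finset.filter_subset _ _)
    have hsum' : (#(richSums Λ k) : ℝ) * k ≤ (#Λ : ℝ) ^ 2 := by exact_mod_cast hsum
    set n : ℝ := (#Λ : ℝ) with hn
    have hn0 : 0 ≤ n := Nat.cast_nonneg _
    have hkle : (k : ℝ) ≤ 4 * B + √n := by
      rw [not_and_or, not_le, not_le] at hk
      have := Real.sqrt_nonneg n
      rcases hk with h | h <;> linarith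
    have hB11 : B ≤ B ^ 11 := le_self_pow₀ hB (by norm_num)
    calc (#(richSums Λ k) : ℝ) * k ^ 2 = #(richSums Λ k) * k * k := by ring
      _ ≤ n ^ 2 * (4 * B + √n) := by gcongr
      _ = 4 * B * n ^ 2 + √n ^ 5 := by
          have : n ^ 2 = √n ^ 4 := by
            rw [show √n ^ 4 = (√n ^ 2) ^ 2 by ring, Real.sq_sqrt hn0]
          rw [mul_add, this]; ring
      _ ≤ 4 * B ^ 11 * √n ^ 5 + B ^ 11 * √n ^ 5 := by
          have e1 : n ^ 2 ≤ √n ^ 5 := card_mul_sq_le_sqrt_pow _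
          have e2 : 1 * √n ^ 5 ≤ B ^ 11 * √n ^ 5 := by
            gcongr; linarith
          have e3 : 4 * B * n ^ 2 ≤ 4 * B ^ 11 * √n ^ 5 := by gcongr
          linarith
      _ = 5 * (B ^ 11 * √n ^ 5) := by ring
      _ ≤ (57 * 21 ^ 5 * 65 ^ 5) * (B ^ 11 * √n ^ 5) := by
          gcongr; norm_num
      _ = _ := by ring

theorem addEnergy_eq_sum_sumReps_sq (Λ : Finset (Fin 5 → ℤ)) :
    Finset.addEnergy Λ Λ = ∑ v ∈ Λ + Λ, sumReps Λ v ^ 2 :=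
  Finset.addEnergy_eq_sum_sq' Λ Λ

/-- Summation over the richness: the energy is controlled by the number of rich sums. -/
theorem addEnergy_le_of_richSums {lam : ℕ} (Λ : Finset (Fin 5 → ℤ))
    (hΛ : (Λ : Set (Fin 5 → ℤ)) ⊆ latticeSphere 5 lam) (W : ℝ) (hW : 0 ≤ W)
    (hrich : ∀ k : ℕ, (#(richSums Λ k) : ℝ) * k ^ 2 ≤ W) :
    (Finset.addEnergy Λ Λ : ℝ) ≤ (#Λ : ℝ) ^ 2 + 2 * W * (1 + Real.log (#Λ + 1)) := by
  classical
  -- Layer-cake form: `r² ≤ r (r + 1)`, the sum of `2 * k` over `1 ≤ k ≤ r`.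
  have hsq : ∀ r ≤ #Λ, r ^ 2 ≤ ∑ k ∈ Icc 1 #Λ, if k ≤ r then 2 * k else 0 := by
    intro r hr
    rw [← Finset.sum_filter]
    have e : ({k ∈ Icc 1 #Λ | k ≤ r} : Finset ℕ) = Icc 1 r := by
      ext k; simp only [Finset.mem_filter, Finset.mem_Icc]; omega
    rw [e]
    clear e hr
    induction r with
    | zero => simp
    | succ r ih =>
      rw [Finset.sum_Icc_succ_top (by omega)]
      nlinarith
  have hrichsum : ∑ v ∈ (Λ + Λ).filter (· ≠ 0), sumReps Λ v ^ 2 ≤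
      ∑ k ∈ Icc 1 #Λ, 2 * k * #(richSums Λ k) := by
    calc _ ≤ ∑ v ∈ (Λ + Λ).filter (· ≠ 0), ∑ k ∈ Icc 1 #Λ,
            (if k ≤ sumReps Λ v then 2 * k else 0) :=
          Finset.sum_le_sum fun v _ => hsq _ (sumReps_le_card hΛ v)
      _ = ∑ k ∈ Icc 1 #Λ, ∑ v ∈ (Λ + Λ).filter (· ≠ 0),
            (if k ≤ sumReps Λ v then 2 * k else 0) := Finset.sum_comm
      _ = _ := by
          refine Finset.sum_congr rfl fun k _ => ?_
          rw [← Finset.sum_filter, Finset.filter_filter, Finset.sum_const, smul_eq_mul, mul_comm]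
          rfl
  -- The sum `0`, incident to every `a`, is kept out of the rich sums and costs only `n²`.
  have hzero : ∑ v ∈ (Λ + Λ).filter (¬ · ≠ 0), sumReps Λ v ^ 2 ≤ #Λ ^ 2 := by
    calc _ ≤ ∑ v ∈ ({0} : Finset (Fin 5 → ℤ)), sumReps Λ v ^ 2 := by
          refine Finset.sum_le_sum_of_subset fun v hv => ?_
          simpa using (Finset.mem_filter.1 hv).2
      _ = sumReps Λ 0 ^ 2 := by simp
      _ ≤ _ := by gcongr; exact sumReps_le_card hΛ 0
  have hE : Finset.addEnergy Λ Λ ≤ ∑ k ∈ Icc 1 #Λ, 2 * k * #(richSums Λ k) + #Λ ^ 2 := by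
    rw [addEnergy_eq_sum_sumReps_sq, ← Finset.sum_filter_add_sum_filter_not _ (· ≠ 0)]
    exact Nat.add_le_add hrichsum hzero
  have hharm : ∑ k ∈ Icc 1 #Λ, (k : ℝ)⁻¹ ≤ 1 + Real.log (#Λ + 1) := by
    have h := harmonic_le_one_add_log #Λ
    rw [harmonic_eq_sum_Icc] at h
    push_cast at h
    refine h.trans ?_
    rcases Nat.eq_zero_or_pos #Λ with h0 | h0
    · simp [h0]
    · have : (0 : ℝ) < #Λ := by exact_mod_cast h0
      gcongr
      linarith
  calc (Finset.addEnergy Λ Λ : ℝ)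
      ≤ ∑ k ∈ Icc 1 #Λ, 2 * (k : ℝ) * #(richSums Λ k) + (#Λ : ℝ) ^ 2 := by exact_mod_cast hE
    _ ≤ ∑ k ∈ Icc 1 #Λ, 2 * W * (k : ℝ)⁻¹ + (#Λ : ℝ) ^ 2 := by
        refine add_le_add_left (Finset.sum_le_sum fun k hk => ?_) _
        have hk0 : (0 : ℝ) < k := by exact_mod_cast (Finset.mem_Icc.1 hk).1
        rw [← div_eq_mul_inv, le_div_iff₀ hk0]
        nlinarith [hrich k]
    _ = (#Λ : ℝ) ^ 2 + 2 * W * ∑ k ∈ Icc 1 #Λ, (k : ℝ)⁻¹ := by rw [Finset.mul_sum]; ring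
    _ ≤ _ := by gcongr

/-- A crude box count is enough, since only the logarithm of `#Λ` is used. -/
theorem card_add_one_le_of_subset_latticeSphere {lam : ℕ} (Λ : Finset (Fin 5 → ℤ))
    (hlam : 1 ≤ lam) (hΛ : (Λ : Set (Fin 5 → ℤ)) ⊆ latticeSphere 5 lam) :
    #Λ + 1 ≤ (2 * scaleN lam) ^ 10 := by
  have hN : lam ≤ scaleN lam ^ 2 := by
    rw [scaleN, sq]; exact (Nat.lt_succ_sqrt lam).le
  have hsub : Λ ⊆ Finset.Icc (fun _ : Fin 5 => -(lam : ℤ)) (fun _ => (lam : ℤ)) := by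
    intro a ha
    have hda := dotProduct_eq_of_mem_latticeSphere (hΛ ha)
    have hi : ∀ i, |a i| ≤ (lam : ℤ) := by
      intro i
      have h1 : a i * a i ≤ (lam : ℤ) := by
        rw [← hda]
        exact Finset.single_le_sum (f := fun j => a j * a j) (fun j _ => mul_self_nonneg _)
          (Finset.mem_univ i)
      have h2 := Int.le_self_sq |a i|
      rw [sq_abs] at h2
      nlinarith
    rw [Finset.mem_Icc]
    exact ⟨fun i => (abs_le.1 (hi i)).1, fun i => (abs_le.1 (hi i)).2⟩
  have hcard : #Λ ≤ (2 * lam + 1) ^ 5 := by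
    refine (Finset.card_le_card hsub).trans (le_of_eq ?_)
    rw [Pi.card_Icc]
    simp only [Int.card_Icc, Finset.prod_const, Finset.card_univ, Fintype.card_fin]
    congr 1
    omega
  calc #Λ + 1 ≤ (2 * lam + 1) ^ 5 + 1 := by gcongr
    _ ≤ (2 * lam + 1 + 1) ^ 5 := by
        have : ∀ x : ℕ, x ^ 5 + 1 ≤ (x + 1) ^ 5 := fun x => by
          have e : (x + 1) ^ 5 = x ^ 5 + 1 + (5 * x ^ 4 + 10 * x ^ 3 + 10 * x ^ 2 + 5 * x) := by ring
          omega
        exact this _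
    _ ≤ (4 * scaleN lam ^ 2) ^ 5 := by gcongr; omega
    _ = _ := by ring

theorem mainTheorem3 (ε : ℝ) (hε : 0 < ε) :
    ∃ C : ℝ, 0 < C ∧ ∀ lam : ℕ, 1 ≤ lam →
      ∀ Λ : Finset (Fin 5 → ℤ), (Λ : Set (Fin 5 → ℤ)) ⊆ latticeSphere 5 lam →
        (Finset.addEnergy Λ Λ : ℝ) ≤
          C * (scaleN lam : ℝ) ^ ε * (Λ.card : ℝ) ^ (5 / 2 : ℝ) := by
  -- The rich sum bound costs `B ^ 11` and the logarithm one more `B`, with `B = K * N ^ η`.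
  set η : ℝ := ε / 12 with hη
  have hη0 : 0 < η := by positivity
  obtain ⟨C, hC2, hC⟩ := exists_card_common_neighbours_le η hη0
  set K : ℝ := C + 730 * (2 ^ η / η) with hK
  have hKC : C ≤ K := by
    have : 0 < 730 * ((2 : ℝ) ^ η / η) := by positivity
    linarith
  have hK0 : 0 < K := by linarith
  refine ⟨(1 + 4 * (57 * 21 ^ 5 * 65 ^ 5)) * K ^ 12, by positivity, fun lam hlam Λ hΛ => ?_⟩
  have hN1 : (1 : ℝ) ≤ scaleN lam := by simp [scaleN]
  have hN0 : (0 : ℝ) < scaleN lam := by linarith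
  have hNη : (1 : ℝ) ≤ (scaleN lam : ℝ) ^ η := Real.one_le_rpow hN1 hη0.le
  set B : ℝ := K * (scaleN lam : ℝ) ^ η with hB
  have hCB : C * (scaleN lam : ℝ) ^ η ≤ B := by rw [hB]; gcongr
  have hB1 : 1 ≤ B := by nlinarith
  have hlog : 73 * Real.log (#Λ + 1) ≤ B := by
    have h1 : ((#Λ : ℝ) + 1) ≤ (2 * (scaleN lam : ℝ)) ^ 10 := by
      exact_mod_cast card_add_one_le_of_subset_latticeSphere Λ hlam hΛ
    have h2 : Real.log (2 * (scaleN lam : ℝ)) ≤ (2 * (scaleN lam : ℝ)) ^ η / η :=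
      Real.log_le_rpow_div (by positivity) hη0
    rw [Real.mul_rpow (by norm_num) hN0.le] at h2
    have h3 : Real.log (#Λ + 1) ≤ 10 * Real.log (2 * (scaleN lam : ℝ)) := by
      refine (Real.log_le_log (by positivity) h1).trans (le_of_eq ?_)
      rw [Real.log_pow]; norm_num
    calc 73 * Real.log (#Λ + 1) ≤ 730 * (2 ^ η * (scaleN lam : ℝ) ^ η / η) := by linarith
      _ = 730 * (2 ^ η / η) * (scaleN lam : ℝ) ^ η := by ring
      _ ≤ B := by
          rw [hB, hK]
          gcongr
          linarith
  obtain ⟨hc1, hc2⟩ := hC lam hlam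
  have hrich := card_richSums_mul_sq_le Λ hΛ B hB1
    (fun P hP v hv hinc => (hc1 P ((Finset.coe_subset.2 hP).trans hΛ) v hv hinc).trans hCB)
    (fun a ha v₁ v₂ a1 a2 a3 a4 a5 V hV => (hc2 a (hΛ ha) v₁ v₂ a1 a2 a3 a4 a5 V hV).trans hCB)
    hlog
  have hE := addEnergy_le_of_richSums Λ hΛ _ (by positivity) hrich
  have hsqrt : √(#Λ : ℝ) ^ 5 = (#Λ : ℝ) ^ (5 / 2 : ℝ) := by
    rw [Real.sqrt_eq_rpow, ← Real.rpow_natCast, ← Real.rpow_mul (Nat.cast_nonneg _)]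
    norm_num
  have hBpow : B ^ 12 = K ^ 12 * (scaleN lam : ℝ) ^ ε := by
    rw [hB, mul_pow, ← Real.rpow_natCast ((scaleN lam : ℝ) ^ η), ← Real.rpow_mul hN0.le]
    congr 2
    rw [hη]; push_cast; ring
  have hlog0 : 0 ≤ Real.log (#Λ + 1 : ℝ) := Real.log_nonneg (by
    have : (0 : ℝ) ≤ #Λ := Nat.cast_nonneg _
    linarith)
  have hlogB : 1 + Real.log (#Λ + 1 : ℝ) ≤ 2 * B := by linarith
  calc (Finset.addEnergy Λ Λ : ℝ) ≤ (#Λ : ℝ) ^ 2 +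
        2 * (57 * 21 ^ 5 * 65 ^ 5 * B ^ 11 * √(#Λ) ^ 5) * (1 + Real.log (#Λ + 1)) := hE
    _ ≤ B ^ 12 * √(#Λ) ^ 5 + 2 * (57 * 21 ^ 5 * 65 ^ 5 * B ^ 11 * √(#Λ) ^ 5) * (2 * B) := by
        gcongr
        calc (#Λ : ℝ) ^ 2 ≤ 1 * √(#Λ) ^ 5 := by
              rw [one_mul]; exact card_mul_sq_le_sqrt_pow _
          _ ≤ _ := by gcongr; exact one_le_pow₀ hB1
    _ = (1 + 4 * (57 * 21 ^ 5 * 65 ^ 5)) * B ^ 12 * √(#Λ) ^ 5 := by ring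
    _ = _ := by rw [hBpow, hsqrt]; ring
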